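/- Notation. $\mathbb{R}_+=(0,\infty)$, $\mathbb{N}=\{0,1,2,\ldots\}$; functions are $g\colon\mathbb{R}_+\to\mathbb{R}$; $\Delta g(x)=g(x+1)-g(x)$; $\binom{x}{j}=x(x-1)\cdots(x-j+1)/j!$. $\mathcal{C}^r$ is the set of $r$ times continuously differentiable functions on $\mathbb{R}_+$. For $p\in\mathbb{N}$, $\mathcal{K}^p$ is the set of functions that on some neighbourhood of infinity are $p$-convex (all divided differences $g[x_0,\ldots,x_{p+1}]$ with $x_0<\cdots<x_{p+1}$ are $\ge 0$) or $p$-concave (all are $\le 0$). $\mathcal{D}^p\cap\mathcal{K}^p$ is the set of $g\in\mathcal{K}^p$ with $\Delta^pg(n)\to 0$ as $n\to\infty$, $n\in\mathbb{N}$. The asymptotic degree is $\deg g=-1+\min\{q\in\mathbb{N}:\Delta^qg(x)\to0\text{ as }x\to\infty,\ x\in\mathbb{R}\}$ ($\infty$ if there is no such $q$). For $g\in\mathcal{D}^p\cap\mathcal{K}^p$ put $$\Sigma g(x)=\lim_{n\to\infty}\Big(-g(x)+\sum_{k=1}^{n-1}(g(k)-g(x+k))+\sum_{j=1}^p\tbinom{x}{j}\Delta^{j-1}g(n)\Big),\qquad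 x>0,$$ which does not depend on the choice of $p$. If moreover $g$ is continuous, put $\sigma[g]=\int_0^1\Sigma g(t+1)\,dt$ and, with $q=1+\deg g$, $$\gamma[g]=-\lim_{n\to\infty}\int_0^1\sum_{k=1}^{n-1}\Big(g(t+k)-\sum_{j=0}^{q}\tbinom{t}{j}\Delta^jg(k)\Big)dt .$$ A series $\sum_{k\ge1}u_k$ with sum $S$ on $[0,\infty)$ *can be repeatedly integrated term by term* if the $u_k$ and $S$ are continuous on $[0,\infty)$ and, for every finite list $a_1,\ldots,a_m\ge0$, applying the successive operators $f\mapsto\int_{a_i}^{x}f(t)\,dt$ to the terms gives a series that converges to the result of applying them to $S$, uniformly on bounded subsets of $[0,\infty)$. It *can be differentiated term by term up to $r$ times* if the $u_k$ and $S$ are of class $\mathcal{C}^r$ on $\mathbb{R}_+$ and, for $0\le j\le r$, $\sum_{k\ge1} u_k^{(j)}$ converges to $S^{(j)}$ uniformly on bounded subsets of $\mathbb{R}_+$. **Theorem.** Let $g\colon\mathbb{R}_+\to\mathbb{R}$. **(I) Eulerian form.** Let $g\in\mathcal{D}^p\cap\mathcal{K}^p$ for some $p\in\mathbb{N}$. (a)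 For any $x>0$, $$\Sigma g(x)=-g(x)+\sum_{j=1}^p\tbinom{x}{j}\Delta^{j-1}g(1)-\sum_{k=1}^\infty\Big(g(x+k)-\sum_{j=0}^p\tbinom{x}{j}\Delta^jg(k)\Big)$$ and the series converges uniformly on any bounded subset of $[0,\infty)$. (b) If $g\in\mathcal{C}^0$, then $\Sigma g\in\mathcal{C}^0$ and the series can be repeatedly integrated term by term. (c) If $g\in\mathcal{C}^r\cap\mathcal{K}^{\max\{p,r\}}$ for some $r\in\mathbb{N}$, then $\Sigma g\in\mathcal{C}^r$ and the series can be differentiated term by term up to $r$ times. **(II) Weierstrassian form, $\deg g=-1$.** Let $g\in\mathcal{C}^0\cap\mathcal{D}^0\cap\mathcal{K}^0$. (a) The limit defining $\gamma[g]$ exists and $\gamma[g]=\sigma[g]$. (b) For any $x>0$, $$\Sigma g(x)=\sigma[g]-g(x)-\sum_{k=1}^\infty\Big(g(x+k)-\int_k^{k+1}g(t)\,dt\Big)$$ and the series converges uniformly on any bounded subset of $[0,\infty)$. (c) $\Sigma g\in\mathcal{C}^0$ and the series can be repeatedly integrated term by term. (d) If $g\in\mathcal{C}^r\cap\mathcal{K}^r$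 for some $r\in\mathbb{N}$, then $\Sigma g\in\mathcal{C}^r$ and the series can be differentiated term by term up to $r$ times. **(III) Weierstrassian form, $\deg g\ge0$.** Let $g\in\mathcal{C}^p\cap\mathcal{D}^p\cap\mathcal{K}^p$ with $\deg g=p-1$ for some integer $p\ge1$. (a) The limit defining $\gamma[g^{(p)}]$ exists and $\gamma[g^{(p)}]=\sigma[g^{(p)}]=g^{(p-1)}(1)-(\Sigma g)^{(p)}(1)$. (b) For any $x>0$, $$\Sigma g(x)=\sum_{j=1}^{p-1}\tbinom{x}{j}\Delta^{j-1}g(1)+\tbinom{x}{p}(\Sigma g)^{(p)}(1)-g(x)-\sum_{k=1}^\infty\Big(g(x+k)-\sum_{j=0}^{p-1}\tbinom{x}{j}\Delta^jg(k)-\tbinom{x}{p}g^{(p)}(k)\Big)$$ and the series converges uniformly on any bounded subset of $[0,\infty)$. (c) $\Sigma g\in\mathcal{C}^p$ and the series can be repeatedly integrated term by term. (d) If $g\in\mathcal{C}^{\max\{p,r\}}\cap\mathcal{K}^{\max\{p,r\}}$ for some $r\in\mathbb{N}$, then $\Sigma g\in\mathcal{C}^{\max\{p,r\}}$ and the series can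 be differentiated term by term up to $\max\{p,r\}$ times. -/

import Mathlib

open Set Filter Topology MeasureTheory

noncomputable section

namespace PrincipalSum

/-! Functions `ℝ₊ → ℝ`, with `ℝ₊ = (0, ∞)`, are represented by functions `ℝ → ℝ` of which only the
values on `Set.Ioi 0` matter.  `(fwdDiff (1 : ℝ))^[j] g` is the `j`-th forward difference with step `1`, and
`Ring.choose x j` is the binomial coefficient `x (x-1) ⋯ (x-j+1) / j!`. -/

/-- The divided difference `f[x₀, …, xₙ]` at pairwise distinct points. -/
def dividedDiff {n : ℕ} (f : ℝ → ℝ) (x : Fin (n + 1) → ℝ) : ℝ :=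
  ∑ k, f (x k) / ∏ j ∈ Finset.univ.erase k, (x k - x j)

/-- `f` is `p`-convex on `I`: the divided differences at `p + 2` increasing points are `≥ 0`. -/
def ConvexOfOrderOn (p : ℕ) (f : ℝ → ℝ) (I : Set ℝ) : Prop :=
  ∀ x : Fin (p + 1 + 1) → ℝ, StrictMono x → (∀ i, x i ∈ I) → 0 ≤ dividedDiff f x

/-- `f` is `p`-concave on `I`. -/
def ConcaveOfOrderOn (p : ℕ) (f : ℝ → ℝ) (I : Set ℝ) : Prop :=
  ∀ x : Fin (p + 1 + 1) → ℝ, StrictMono x → (∀ i, x i ∈ I) → dividedDiff f x ≤ 0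

/-- The class `𝒦^p`: eventually `p`-convex or eventually `p`-concave. -/
def InK (p : ℕ) (f : ℝ → ℝ) : Prop :=
  (∃ a : ℝ, 0 < a ∧ ConvexOfOrderOn p f (Ioi a)) ∨
    (∃ a : ℝ, 0 < a ∧ ConcaveOfOrderOn p f (Ioi a))

/-- The class `𝒟^p_ℕ`: `Δ^p f(n) → 0` along the integers. -/
def InDNat (p : ℕ) (f : ℝ → ℝ) : Prop :=
  Tendsto (fun n : ℕ => ((fwdDiff (1 : ℝ))^[p] f) (n : ℝ)) atTop (𝓝 0)

/-- The class `𝒟^p_ℝ`: `Δ^p f(x) → 0` as `x → ∞`. -/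
def InDReal (p : ℕ) (f : ℝ → ℝ) : Prop :=
  Tendsto ((fwdDiff (1 : ℝ))^[p] f) atTop (𝓝 0)

/-- The class `𝒟^p ∩ 𝒦^p`. -/
def InDK (p : ℕ) (f : ℝ → ℝ) : Prop := InDNat p f ∧ InK p f

/-- The class `𝒞^r` of functions on `(0, ∞)`. -/
def InC (r : ℕ) (f : ℝ → ℝ) : Prop := ContDiffOn ℝ r f (Ioi 0)

/-- `min {q : f ∈ 𝒟^q_ℝ}`, i.e. `1 + deg f` (meaningful when `deg f` is finite). -/
def succDeg (f : ℝ → ℝ) : ℕ := sInf {q : ℕ | InDReal q f}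

open Classical in
/-- The asymptotic degree `deg f = -1 + min {q : f ∈ 𝒟^q_ℝ}`, which is `∞` if there is no such `q`. -/
def asympDeg (f : ℝ → ℝ) : WithTop ℤ :=
  if ∃ q : ℕ, InDReal q f then (((succDeg f : ℤ) - 1 : ℤ) : WithTop ℤ) else ⊤

/-- `f^p_n[g](x) = -g(x) + ∑_{k=1}^{n-1} (g(k) - g(x+k)) + ∑_{j=1}^p C(x,j) Δ^{j-1} g(n)`. -/
def gaussSeq (p n : ℕ) (g : ℝ → ℝ) (x : ℝ) : ℝ :=
  -g x + ∑ k ∈ Finset.Ico 1 n, (g k - g (x + k)) +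
    ∑ j ∈ Finset.Icc 1 p, Ring.choose x j * ((fwdDiff (1 : ℝ))^[j - 1] g) (n : ℝ)

open Classical in
/-- The map `Σ` on `dom Σ = ⋃_p 𝒟^p ∩ 𝒦^p`: the pointwise limit of `f^p_n[g]` as `n → ∞`, for a `p`
such that `g ∈ 𝒟^p ∩ 𝒦^p` (the least one is used here; the value `0` off the domain is junk). -/
def Sig (g : ℝ → ℝ) (x : ℝ) : ℝ :=
  if h : ∃ p : ℕ, InDK p g then limUnder atTop (fun n : ℕ => gaussSeq (Nat.find h) n g x) else 0

/-- The asymptotic constant `σ[g] = ∫_0^1 Σg(t+1) dt`. -/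
def asympConst (g : ℝ → ℝ) : ℝ := ∫ t in (0 : ℝ)..1, Sig g (t + 1)

/-- `ρ^p_a[g](x) = g(x+a) - ∑_{j=0}^{p-1} C(x,j) Δ^j g(a)`. -/
def rho (p : ℕ) (a : ℝ) (g : ℝ → ℝ) (x : ℝ) : ℝ :=
  g (x + a) - ∑ j ∈ Finset.range p, Ring.choose x j * ((fwdDiff (1 : ℝ))^[j] g) a

/-- The remainder in Gregory's formula: `R^q_{m,n}[g] = ∫_0^1 ∑_{k=m}^{n-1} ρ^{q+1}_k[g](t) dt`. -/
def gregoryRem (q m n : ℕ) (g : ℝ → ℝ) : ℝ :=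
  ∫ t in (0 : ℝ)..1, ∑ k ∈ Finset.Ico m n, rho (q + 1) k g t

/-- The generalized Euler constant `γ[g] = -R^p_{1,∞}[g] = -lim_n R^p_{1,n}[g]`, `p = 1 + deg g`. -/
def eulerConst (g : ℝ → ℝ) : ℝ :=
  limUnder atTop (fun n : ℕ => -gregoryRem (succDeg g) 1 n g)

/-- The limit that defines `γ[g]` exists (so that `eulerConst g` is its value). -/
def HasEulerConst (g : ℝ → ℝ) : Prop :=
  Tendsto (fun n : ℕ => -gregoryRem (succDeg g) 1 n g) atTop (𝓝 (eulerConst g))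

/-- The series `∑_{k ≥ 1} u k` converges to `S`, uniformly on every bounded subset of `A`. -/
def SumsUniformlyOnBounded (A : Set ℝ) (u : ℕ → ℝ → ℝ) (S : ℝ → ℝ) : Prop :=
  ∀ E : Set ℝ, E ⊆ A → Bornology.IsBounded E →
    TendstoUniformlyOn (fun (n : ℕ) (x : ℝ) => ∑ k ∈ Finset.Icc 1 n, u k x) S atTop E

/-- Repeated integration with the given list of base points:
`iterInt [a₁, …, aₘ] f (x) = ∫_{a₁}^x ∫_{a₂}^{t₁} ⋯ ∫_{aₘ}^{tₘ₋₁} f(tₘ) dtₘ ⋯ dt₁`. -/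
def iterInt : List ℝ → (ℝ → ℝ) → ℝ → ℝ
  | [], f => f
  | a :: l, f => fun x => ∫ t in a..x, iterInt l f t

/-- The series `∑_{k ≥ 1} u k = S` can be repeatedly integrated term by term on bounded intervals
of `[0, ∞)`: terms and sum are continuous there, and for all base points in `[0, ∞)` the series of
repeated integrals converges to the repeated integral of `S`, uniformly on bounded subsets. -/
def IntegrableTermwise (u : ℕ → ℝ → ℝ) (S : ℝ → ℝ) : Prop :=
  (∀ k, 1 ≤ k → ContinuousOn (u k) (Ici 0)) ∧ ContinuousOn S (Ici 0) ∧
    ∀ l : List ℝ, (∀ a ∈ l, 0 ≤ a) →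
      SumsUniformlyOnBounded (Ici 0) (fun k => iterInt l (u k)) (iterInt l S)

/-- The series `∑_{k ≥ 1} u k = S` can be differentiated term by term up to `r` times on `(0, ∞)`:
terms and sum are of class `𝒞^r` there, and for `j ≤ r` the series of `j`-th derivatives converges
to the `j`-th derivative of `S`, uniformly on bounded subsets of `(0, ∞)`. -/
def DifferentiableTermwise (r : ℕ) (u : ℕ → ℝ → ℝ) (S : ℝ → ℝ) : Prop :=
  (∀ k, 1 ≤ k → InC r (u k)) ∧ InC r S ∧
    ∀ j, j ≤ r →
      SumsUniformlyOnBounded (Ioi 0) (fun k => iteratedDeriv j (u k)) (iteratedDeriv j S)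

/-- The `k`-th term of the Eulerian series: `g(x+k) - ∑_{j=0}^p C(x,j) Δ^j g(k)`. -/
def eulerTerm (p : ℕ) (g : ℝ → ℝ) (k : ℕ) (x : ℝ) : ℝ :=
  g (x + k) - ∑ j ∈ Finset.range (p + 1), Ring.choose x j * ((fwdDiff (1 : ℝ))^[j] g) (k : ℝ)

/-- The `k`-th term of the Weierstrassian series for `p = 0`: `g(x+k) - ∫_k^{k+1} g(t) dt`. -/
def weierTermZero (g : ℝ → ℝ) (k : ℕ) (x : ℝ) : ℝ :=
  g (x + k) - ∫ t in (k : ℝ)..(k + 1), g t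

/-- The `k`-th term of the Weierstrassian series for `p ≥ 1`:
`g(x+k) - ∑_{j=0}^{p-1} C(x,j) Δ^j g(k) - C(x,p) g^{(p)}(k)`. -/
def weierTerm (p : ℕ) (g : ℝ → ℝ) (k : ℕ) (x : ℝ) : ℝ :=
  g (x + k) - ∑ j ∈ Finset.range p, Ring.choose x j * ((fwdDiff (1 : ℝ))^[j] g) (k : ℝ)
    - Ring.choose x p * iteratedDeriv p g k

end PrincipalSum

end

open PrincipalSum

namespace PrincipalSum

/-! The Eulerian term is the error of Newton interpolation of `g` at `k, …, k + p`, evaluated at `k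
+ x`. By Newton's formula it is a product of `p + 1` linear factors in `x` times a divided
difference at `p + 2` points. Absorbing the factor `x` turns this into a difference of two divided
differences at `p + 1` points. For `p`-convex `g` these increase in each node, so the error is at
most a constant times `Δ^p g(k+M) - Δ^p g(k)`, a telescoping summable bound since `Δ^p g(n) → 0`
(`ConvexOfOrderOn.abs_eulerTerm_le`, `InDK.exists_summable_bound`). The concave case follows by
changing sign. Uniform convergence on bounded sets then permits repeated integration.

For derivatives, `g ↦ g'` maps the class of order `p + 1` to that of order `p` (`InDK.inDK_deriv`).
The Eulerian series of `g'`, integrated from `0`, agrees with the original series up to polynomials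
of bounded degree. A pointwise convergent series of such polynomials converges together with its
derivative (`exists_polynomial_sum`), whence `InDK.differentiableTermwise_shift`.

The Weierstrassian forms add to the Eulerian terms a convergent number series times `1` or `C(x,p)`.
For `p = 0` that series is the Eulerian one integrated over `[0, 1]`, with sum `σ[g]` up to sign.
For `p ≥ 1` it is `∑ (Δ^p g(k) - g^{(p)}(k))`, obtained by comparing the `p`-th derivative of the
Eulerian series of `g` with the order-`0` series of `g^{(p)}`. -/

/-! ### Divided differences over finite sets -/

/-- The divided difference of `f` at the points of a finite set. -/
noncomputable def finsetDividedDiff (f : ℝ → ℝ) (s : Finset ℝ) : ℝ :=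
  ∑ x ∈ s, f x / ∏ y ∈ s.erase x, (x - y)

lemma dividedDiff_eq_finset {n : ℕ} (f : ℝ → ℝ) (x : Fin (n + 1) → ℝ)
    (hx : Function.Injective x) :
    dividedDiff f x = finsetDividedDiff f (Finset.univ.image x) := by
  unfold dividedDiff finsetDividedDiff
  rw [Finset.sum_image (fun a _ b _ h => hx h)]
  refine Finset.sum_congr rfl fun k _ => ?_
  rw [← Finset.image_erase hx, Finset.prod_image (fun a _ b _ h => hx h)]

/-- Divided differences are symmetric in their nodes, so the increasing order is immaterial; with
sets, nodes can be exchanged without sorting again. -/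
lemma convexOfOrderOn_iff {p : ℕ} {f : ℝ → ℝ} {I : Set ℝ} :
    ConvexOfOrderOn p f I ↔
      ∀ s : Finset ℝ, s.card = p + 2 → (∀ x ∈ s, x ∈ I) → 0 ≤ finsetDividedDiff f s := by
  constructor
  · intro h s hs hI
    have := h (s.orderEmbOfFin hs) (s.orderEmbOfFin hs).strictMono
      (fun i => hI _ (Finset.orderEmbOfFin_mem s hs i))
    rwa [dividedDiff_eq_finset _ _ (s.orderEmbOfFin hs).injective,
      Finset.image_orderEmbOfFin_univ] at this
  · intro h x hx hI
    rw [dividedDiff_eq_finset _ _ hx.injective]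
    refine h _ ?_ ?_
    · rw [Finset.card_image_of_injective _ hx.injective]; simp
    · intro y hy
      obtain ⟨i, -, rfl⟩ := Finset.mem_image.1 hy
      exact hI i

lemma dividedDiff_neg {n : ℕ} (f : ℝ → ℝ) (x : Fin (n + 1) → ℝ) :
    dividedDiff (-f) x = -dividedDiff f x := by
  simp [dividedDiff, neg_div]

lemma concaveOfOrderOn_iff_neg {p : ℕ} {f : ℝ → ℝ} {I : Set ℝ} :
    ConcaveOfOrderOn p f I ↔ ConvexOfOrderOn p (-f) I := by
  simp [ConcaveOfOrderOn, ConvexOfOrderOn, dividedDiff_neg]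

/-- The recursion for divided differences, from the partial fraction `(a - b) / ((x - a)(x - b)) = 1
/ (x - a) - 1 / (x - b)` applied at each common node. -/
lemma finsetDividedDiff_insert_sub_insert (f : ℝ → ℝ) {t : Finset ℝ} {a b : ℝ} (ha : a ∉ t)
    (hb : b ∉ t) (hab : a ≠ b) :
    finsetDividedDiff f (insert a t) - finsetDividedDiff f (insert b t) =
      (a - b) * finsetDividedDiff f (insert a (insert b t)) := by
  have hab' : a ∉ insert b t := by simp [hab, ha]
  have key : ∀ c, c ∉ t → finsetDividedDiff f (insert c t) =
      f c / ∏ y ∈ t, (c - y) + ∑ x ∈ t, f x / ((x - c) * ∏ y ∈ t.erase x, (x - y)) := by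
    intro c hc
    unfold finsetDividedDiff
    rw [Finset.sum_insert hc, Finset.erase_insert hc]
    congr 1
    refine Finset.sum_congr rfl fun x hx => ?_
    have hcx : c ≠ x := fun h => hc (h ▸ hx)
    rw [Finset.erase_insert_of_ne hcx, Finset.prod_insert (by simp [hc])]
  have hab0 : a - b ≠ 0 := sub_ne_zero.2 hab
  have hba0 : b - a ≠ 0 := sub_ne_zero.2 hab.symm
  have e1 : finsetDividedDiff f (insert a (insert b t)) =
      f a / ((a - b) * ∏ y ∈ t, (a - y)) + (f b / ((b - a) * ∏ y ∈ t, (b - y)) +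
        ∑ x ∈ t, f x / ((x - a) * ((x - b) * ∏ y ∈ t.erase x, (x - y)))) := by
    unfold finsetDividedDiff
    rw [Finset.sum_insert hab', Finset.erase_insert hab', Finset.prod_insert hb,
      Finset.sum_insert hb, Finset.erase_insert_of_ne hab, Finset.erase_insert hb,
      Finset.prod_insert ha]
    congr 2
    refine Finset.sum_congr rfl fun x hx => ?_
    have hax : a ≠ x := fun h => ha (h ▸ hx)
    have hbx : b ≠ x := fun h => hb (h ▸ hx)
    rw [Finset.erase_insert_of_ne hax, Finset.erase_insert_of_ne hbx,
      Finset.prod_insert (by simp [ha, hab]), Finset.prod_insert (by simp [hb])]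
  rw [key a ha, key b hb, e1, mul_add, mul_add, Finset.mul_sum]
  have e2 : ∑ x ∈ t, (a - b) * (f x / ((x - a) * ((x - b) * ∏ y ∈ t.erase x, (x - y)))) =
      ∑ x ∈ t, f x / ((x - a) * ∏ y ∈ t.erase x, (x - y)) -
        ∑ x ∈ t, f x / ((x - b) * ∏ y ∈ t.erase x, (x - y)) := by
    rw [← Finset.sum_sub_distrib]
    refine Finset.sum_congr rfl fun x hx => ?_
    have hax : x - a ≠ 0 := sub_ne_zero.2 fun h => ha (h ▸ hx)
    have hbx : x - b ≠ 0 := sub_ne_zero.2 fun h => hb (h ▸ hx)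
    have hP : ∏ y ∈ t.erase x, (x - y) ≠ 0 :=
      Finset.prod_ne_zero_iff.2 fun y hy => sub_ne_zero.2 (Finset.ne_of_mem_erase hy).symm
    field_simp
    ring
  have hPa : ∏ y ∈ t, (a - y) ≠ 0 :=
    Finset.prod_ne_zero_iff.2 fun y hy => sub_ne_zero.2 fun h => ha (h ▸ hy)
  have hPb : ∏ y ∈ t, (b - y) ≠ 0 :=
    Finset.prod_ne_zero_iff.2 fun y hy => sub_ne_zero.2 fun h => hb (h ▸ hy)
  have e3 : (a - b) * (f a / ((a - b) * ∏ y ∈ t, (a - y))) = f a / ∏ y ∈ t, (a - y) := by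
    field_simp
  have e4 : (a - b) * (f b / ((b - a) * ∏ y ∈ t, (b - y))) = -(f b / ∏ y ∈ t, (b - y)) := by
    field_simp
    ring
  rw [e2, e3, e4]
  ring

/-! ### Monotonicity of divided differences in the nodes -/

section Monotone

variable {p : ℕ} {f : ℝ → ℝ} {I : Set ℝ}

/-- By the recursion, the gap between the two sides is `b - a` times a divided difference at `p + 2`
points. -/
lemma ConvexOfOrderOn.dividedDiff_swap_le (hf : ConvexOfOrderOn p f I) {t : Finset ℝ}
    (ht : t.card = p) (htI : ∀ x ∈ t, x ∈ I) {a b : ℝ} (ha : a ∉ t) (hb : b ∉ t) (hab : a < b)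
    (haI : a ∈ I) (hbI : b ∈ I) :
    finsetDividedDiff f (insert a t) ≤ finsetDividedDiff f (insert b t) := by
  have hba : b ∉ insert a t := by simp [hab.ne', hb]
  have h := convexOfOrderOn_iff.1 hf (insert b (insert a t))
    (by rw [Finset.card_insert_of_notMem hba, Finset.card_insert_of_notMem ha, ht])
    (by
      intro x hx
      rw [Finset.mem_insert, Finset.mem_insert] at hx
      rcases hx with rfl | rfl | hx
      exacts [hbI, haI, htI x hx])
  have e := finsetDividedDiff_insert_sub_insert f hb ha hab.ne'
  have := mul_nonneg (sub_nonneg.2 hab.le) h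
  linarith

/-- The nodes of `s` move one at a time; `t` collects the fixed nodes and those already moved. The
disjointness conditions keep the nodes distinct at every stage. -/
lemma ConvexOfOrderOn.dividedDiff_shift_le (hf : ConvexOfOrderOn p f I) {h : ℝ} (hh : 0 < h)
    (s : Finset ℝ) : ∀ t : Finset ℝ, t.card + s.card = p + 1 → (∀ x ∈ t, x ∈ I) →
    (∀ x ∈ s, x ∈ I ∧ x + h ∈ I) → (∀ x ∈ s, x ∉ t ∧ x + h ∉ t ∧ x + h ∉ s) →
    finsetDividedDiff f (t ∪ s) ≤ finsetDividedDiff f (t ∪ s.image (· + h)) := by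
  induction s using Finset.induction_on with
  | empty => intro t _ _ _ _; simp
  | insert a s ha ih =>
    intro t hcard htI hsI hdis
    rw [Finset.card_insert_of_notMem ha] at hcard
    obtain ⟨d1, d2, d3⟩ := hdis a (Finset.mem_insert_self a s)
    have d3' : a + h ∉ s := fun h' => d3 (Finset.mem_insert_of_mem h')
    have hdis' : Disjoint t s := Finset.disjoint_left.2 fun x hx hxs =>
      (hdis x (Finset.mem_insert_of_mem hxs)).1 hx
    have h1 : finsetDividedDiff f (t ∪ insert a s) ≤
        finsetDividedDiff f (insert (a + h) (t ∪ s)) := by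
      rw [Finset.union_insert]
      refine hf.dividedDiff_swap_le ?_ ?_ ?_ ?_ (by linarith)
        (hsI a (Finset.mem_insert_self a s)).1 (hsI a (Finset.mem_insert_self a s)).2
      · rw [Finset.card_union_of_disjoint hdis']; omega
      · intro x hx
        rcases Finset.mem_union.1 hx with hx | hx
        exacts [htI x hx, (hsI x (Finset.mem_insert_of_mem hx)).1]
      · simp [d1, ha]
      · simp [d2, d3']
    refine h1.trans ?_
    have h2 := ih (insert (a + h) t)
      (by rw [Finset.card_insert_of_notMem d2]; omega)
      (by
        intro x hx
        rcases Finset.mem_insert.1 hx with rfl | hx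
        exacts [(hsI a (Finset.mem_insert_self a s)).2, htI x hx])
      (fun x hx => hsI x (Finset.mem_insert_of_mem hx))
      (by
        intro x hx
        obtain ⟨c1, c2, c3⟩ := hdis x (Finset.mem_insert_of_mem hx)
        refine ⟨?_, ?_, fun h' => c3 (Finset.mem_insert_of_mem h')⟩
        · rw [Finset.mem_insert, not_or]
          exact ⟨fun h' => d3' (h' ▸ hx), c1⟩
        · rw [Finset.mem_insert, not_or]
          exact ⟨fun h' => ha (add_right_cancel h' ▸ hx), c2⟩)
    rw [Finset.image_insert, Finset.union_insert, ← Finset.insert_union, ← Finset.insert_union]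
    exact h2

end Monotone

/-! ### Unit-spaced nodes, forward differences and Newton's formula -/

/-- The `n` points `x, x + 1, …, x + n - 1`. -/
noncomputable def unitNodes (x : ℝ) (n : ℕ) : Finset ℝ :=
  (Finset.range n).image (fun j : ℕ => x + j)

lemma mem_unitNodes {x y : ℝ} {n : ℕ} : y ∈ unitNodes x n ↔ ∃ j < n, x + (j : ℝ) = y := by
  simp [unitNodes]

lemma card_unitNodes (x : ℝ) (n : ℕ) : (unitNodes x n).card = n := by
  unfold unitNodes
  rw [Finset.card_image_of_injective _ (fun a b h => by simpa using h), Finset.card_range]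

lemma unitNodes_succ (x : ℝ) (n : ℕ) : unitNodes x (n + 1) = insert (x + n) (unitNodes x n) := by
  unfold unitNodes
  rw [Finset.range_add_one, Finset.image_insert]

lemma unitNodes_succ' (x : ℝ) (n : ℕ) : unitNodes x (n + 1) = insert x (unitNodes (x + 1) n) := by
  ext y
  rw [Finset.mem_insert, mem_unitNodes, mem_unitNodes]
  constructor
  · rintro ⟨j, hj, rfl⟩
    rcases j with _ | j
    · left; simp
    · right; exact ⟨j, by omega, by push_cast; ring⟩
  · rintro (rfl | ⟨j, hj, rfl⟩)
    · exact ⟨0, by omega, by simp⟩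
    · exact ⟨j + 1, by omega, by push_cast; ring⟩

lemma unitNodes_image_add (x h : ℝ) (n : ℕ) :
    (unitNodes x n).image (· + h) = unitNodes (x + h) n := by
  unfold unitNodes
  rw [Finset.image_image]
  congr 1
  ext j
  simp only [Function.comp]
  ring

lemma notMem_unitNodes_of_lt {x y : ℝ} {n : ℕ} (h : y < x) : y ∉ unitNodes x n := by
  rw [mem_unitNodes]
  rintro ⟨j, -, rfl⟩
  have : (0 : ℝ) ≤ j := j.cast_nonneg
  linarith

lemma notMem_unitNodes_of_le {x y : ℝ} {n : ℕ} (h : x + n ≤ y) : y ∉ unitNodes x n := by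
  rw [mem_unitNodes]
  rintro ⟨j, hj, rfl⟩
  have : (j : ℝ) < n := by exact_mod_cast hj
  linarith

/-- The recursion for the extreme nodes `x + n + 1` and `x` contributes their distance `n + 1`,
which turns `n!` into `(n + 1)!`. -/
lemma fwdDiff_iter_eq_finsetDividedDiff (f : ℝ → ℝ) (n : ℕ) :
    ∀ x : ℝ, (fwdDiff (1 : ℝ))^[n] f x = n.factorial * finsetDividedDiff f (unitNodes x (n + 1)) := by
  induction n with
  | zero => intro x; simp [finsetDividedDiff, unitNodes]
  | succ n ih =>
    intro x
    rw [Function.iterate_succ_apply', fwdDiff, ih, ih, ← mul_sub]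
    have h1 : unitNodes (x + 1) (n + 1) = insert (x + n + 1) (unitNodes (x + 1) n) := by
      rw [unitNodes_succ]; congr 1; ring
    have hn : (0 : ℝ) ≤ n := n.cast_nonneg
    have h2 : unitNodes x (n + 1 + 1) = insert (x + n + 1) (insert x (unitNodes (x + 1) n)) := by
      rw [unitNodes_succ, unitNodes_succ']; congr 1; push_cast; ring
    rw [h1, unitNodes_succ' x n, finsetDividedDiff_insert_sub_insert, ← h2, Nat.factorial_succ]
    · push_cast; ring
    · exact notMem_unitNodes_of_le (by linarith)
    · exact notMem_unitNodes_of_lt (by linarith)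
    · linarith

lemma ringChoose_real_eq (x : ℝ) (n : ℕ) :
    Ring.choose x n = (∏ j ∈ Finset.range n, (x - j)) / n.factorial := by
  have h : (descPochhammer ℤ n).smeval x = ∏ j ∈ Finset.range n, (x - j) := by
    induction n with
    | zero => simp
    | succ n ih =>
      rw [descPochhammer_succ_right, Polynomial.smeval_mul, ih, Finset.prod_range_succ,
        Polynomial.smeval_sub, Polynomial.smeval_X, Polynomial.smeval_natCast]
      simp
  rw [Ring.choose_eq_smul, h, smul_eq_mul, div_eq_inv_mul]

/-- Newton's formula for the error of interpolation at consecutive integers. -/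
lemma sub_newton_eq_prod_mul_dividedDiff (g : ℝ → ℝ) (k x : ℝ) (p : ℕ)
    (hx : ∀ j : ℕ, j ≤ p → x ≠ j) :
    g (x + k) - ∑ j ∈ Finset.range (p + 1), Ring.choose x j * (fwdDiff (1 : ℝ))^[j] g k =
      (∏ j ∈ Finset.range (p + 1), (x - j)) *
        finsetDividedDiff g (insert (k + x) (unitNodes k (p + 1))) := by
  induction p with
  | zero =>
    have hx0 : x ≠ 0 := by simpa using hx 0 le_rfl
    have h : unitNodes k 1 = insert k ∅ := by simp [unitNodes]
    have e := finsetDividedDiff_insert_sub_insert g (Finset.notMem_empty (k + x))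
      (Finset.notMem_empty k) (by simpa using hx0)
    have h1 : ∀ a, finsetDividedDiff g (insert a ∅) = g a := by simp [finsetDividedDiff]
    rw [h1, h1] at e
    rw [zero_add, Finset.sum_range_one, Finset.prod_range_one, h, add_comm x k]
    simp only [Ring.choose_zero_right, Function.iterate_zero, id, Nat.cast_zero, sub_zero, one_mul]
    rw [e]
    ring
  | succ p ih =>
    rw [Finset.sum_range_succ, ← sub_sub, ih (fun j hj => hx j (by omega)),
      fwdDiff_iter_eq_finsetDividedDiff, ringChoose_real_eq, Finset.prod_range_succ _ (p + 1)]
    have hk : k + x ∉ unitNodes k (p + 1) := by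
      rw [mem_unitNodes]
      rintro ⟨j, hj, h⟩
      exact hx j (by omega) (by linarith)
    have hk2 : k + ((p + 1 : ℕ) : ℝ) ∉ unitNodes k (p + 1) := notMem_unitNodes_of_le le_rfl
    have hne : k + x ≠ k + ((p + 1 : ℕ) : ℝ) := fun h => hx (p + 1) le_rfl (by linarith)
    have e := finsetDividedDiff_insert_sub_insert g hk hk2 hne
    rw [← unitNodes_succ] at e
    have hfac : ((p + 1).factorial : ℝ) ≠ 0 := by positivity
    have e' : (x - ((p + 1 : ℕ) : ℝ)) *
        finsetDividedDiff g (insert (k + x) (unitNodes k (p + 1 + 1))) =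
        finsetDividedDiff g (insert (k + x) (unitNodes k (p + 1))) -
        finsetDividedDiff g (unitNodes k (p + 1 + 1)) := by rw [e]; ring
    rw [mul_assoc, e']
    field_simp

/-! ### Reduction of the concave case to the convex one -/

lemma fwdDiff_iter_neg (g : ℝ → ℝ) (n : ℕ) (x : ℝ) :
    (fwdDiff (1 : ℝ))^[n] (-g) x = -(fwdDiff (1 : ℝ))^[n] g x := by
  have := fwdDiff_iter_const_smul (1 : ℝ) (-1 : ℝ) g n
  rw [show -g = (-1 : ℝ) • g by simp, this]
  simp

lemma eulerTerm_neg (p : ℕ) (g : ℝ → ℝ) (k : ℕ) (x : ℝ) :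
    eulerTerm p (-g) k x = -eulerTerm p g k x := by
  simp only [eulerTerm, fwdDiff_iter_neg, Pi.neg_apply, mul_neg, Finset.sum_neg_distrib]
  ring

lemma inDNat_neg {p : ℕ} {g : ℝ → ℝ} (h : InDNat p g) : InDNat p (-g) := by
  have := Filter.Tendsto.neg h
  rw [neg_zero] at this
  exact this.congr fun n => (fwdDiff_iter_neg g p n).symm

/-- A property of `g` shared with `-g` may be checked in the eventually convex case only. -/
lemma InDK.induction {p : ℕ} {g : ℝ → ℝ} (hg : InDK p g) {Q : (ℝ → ℝ) → Prop}
    (hQ : Q (-g) → Q g)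
    (h : ∀ (f : ℝ → ℝ) (a : ℝ), f = g ∨ f = -g → 0 < a → InDNat p f →
      ConvexOfOrderOn p f (Ioi a) → Q f) : Q g := by
  rcases hg with ⟨hD, ⟨a, ha, hc⟩ | ⟨a, ha, hc⟩⟩
  · exact h g a (Or.inl rfl) ha hD hc
  · exact hQ (h (-g) a (Or.inr rfl) ha (inDNat_neg hD) (concaveOfOrderOn_iff_neg.1 hc))

/-! ### The bound on the interpolation error -/

section Bound

variable {p : ℕ} {g : ℝ → ℝ} {a : ℝ}

/-- A shift by more than `p` carries the `p + 1` unit-spaced nodes past all of their original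
positions, so none collide. -/
lemma ConvexOfOrderOn.fwdDiff_iter_le (hg : ConvexOfOrderOn p g (Ioi a)) {x h : ℝ} (hx : a < x)
    (hh : (p : ℝ) < h) :
    (fwdDiff (1 : ℝ))^[p] g x ≤ (fwdDiff (1 : ℝ))^[p] g (x + h) := by
  have hp : (0 : ℝ) ≤ p := p.cast_nonneg
  rw [fwdDiff_iter_eq_finsetDividedDiff, fwdDiff_iter_eq_finsetDividedDiff]
  refine mul_le_mul_of_nonneg_left ?_ (by positivity)
  have key := hg.dividedDiff_shift_le (h := h) (by linarith) (unitNodes x (p + 1)) ∅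
    (by simp [card_unitNodes]) (by simp) ?_ ?_
  · rwa [Finset.empty_union, Finset.empty_union, unitNodes_image_add] at key
  · intro y hy
    obtain ⟨j, -, rfl⟩ := mem_unitNodes.1 hy
    have hj : (0 : ℝ) ≤ j := j.cast_nonneg
    constructor <;> rw [mem_Ioi] <;> linarith
  · intro y hy
    obtain ⟨j, hj, rfl⟩ := mem_unitNodes.1 hy
    refine ⟨by simp, by simp, ?_⟩
    rw [mem_unitNodes]
    rintro ⟨i, hi, h'⟩
    have hj0 : (0 : ℝ) ≤ j := j.cast_nonneg
    have hi' : (i : ℝ) ≤ p := by exact_mod_cast Nat.lt_succ_iff.1 hi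
    linarith

/-- With `t = {k+1, …, k+p}`, the factor `x` reduces the error to `g[k+x, t] - g[k, t]` times `p`
factors of size at most `M`. Monotonicity bounds the first divided difference by moving `k + x` to
`k + M` and then shifting `t` by `M`, which yields consecutive nodes starting at `k + M`. -/
lemma ConvexOfOrderOn.abs_eulerTerm_le (hg : ConvexOfOrderOn p g (Ioi a)) {k M : ℕ}
    (hk : a < k) (hM : p < M) {x : ℝ} (hx0 : 0 ≤ x) (hxM : x < M) :
    |eulerTerm p g k x| ≤
      M ^ p * ((fwdDiff (1 : ℝ))^[p] g (k + M) - (fwdDiff (1 : ℝ))^[p] g k) := by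
  have hpM : (p : ℝ) < M := by exact_mod_cast hM
  have hmono := hg.fwdDiff_iter_le hk hpM
  have hM0 : (0 : ℝ) ≤ M := M.cast_nonneg
  have hp0 : (0 : ℝ) ≤ p := p.cast_nonneg
  by_cases hx : ∀ j : ℕ, j ≤ p → x ≠ j
  · rw [eulerTerm, sub_newton_eq_prod_mul_dividedDiff g k x p hx, Finset.prod_range_succ']
    have hxpos : 0 < x := lt_of_le_of_ne hx0 (by simpa using (hx 0 (Nat.zero_le _)).symm)
    set t := unitNodes ((k : ℝ) + 1) p with ht
    have htcard : t.card = p := card_unitNodes _ _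
    have htI : ∀ y ∈ t, y ∈ Ioi a := by
      intro y hy
      obtain ⟨j, -, rfl⟩ := mem_unitNodes.1 hy
      have hj : (0 : ℝ) ≤ j := j.cast_nonneg
      rw [mem_Ioi]; linarith
    have h1 : (k : ℝ) + x ∉ t := by
      rw [ht, mem_unitNodes]
      rintro ⟨j, hj, h'⟩
      exact hx (j + 1) hj (by push_cast; linarith)
    have h2 : (k : ℝ) ∉ t := notMem_unitNodes_of_lt (by linarith)
    have h3 : (k : ℝ) + M ∉ t := notMem_unitNodes_of_le (by
      have : (p : ℝ) + 1 ≤ M := by exact_mod_cast hM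
      linarith)
    have e := finsetDividedDiff_insert_sub_insert g h1 h2 (by simpa using hxpos.ne')
    have l1 := hg.dividedDiff_swap_le htcard htI h2 h1 (by linarith) (mem_Ioi.2 hk)
      (mem_Ioi.2 (by linarith))
    have l2 := hg.dividedDiff_swap_le htcard htI h1 h3 (by linarith) (mem_Ioi.2 (by linarith))
      (mem_Ioi.2 (by linarith))
    have l3 := hg.dividedDiff_shift_le (h := M) (by linarith) t {(k : ℝ) + M}
      (by simp [htcard]; omega) (by simpa using by linarith)
      (by
        intro y hy
        have := mem_Ioi.1 (htI y hy)
        constructor <;> rw [mem_Ioi] <;> linarith)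
      (by
        intro y hy
        obtain ⟨j, hj, rfl⟩ := mem_unitNodes.1 hy
        have hj0 : (0 : ℝ) ≤ j := j.cast_nonneg
        have hjp : (j : ℝ) + 1 ≤ p := by exact_mod_cast hj
        refine ⟨?_, ?_, ?_⟩
        · rw [Finset.mem_singleton]; intro h'; linarith
        · rw [Finset.mem_singleton]; intro h'; linarith
        · exact notMem_unitNodes_of_le (by linarith))
    rw [← Finset.insert_eq, ← Finset.insert_eq, ht, unitNodes_image_add] at l3
    rw [show (k : ℝ) + 1 + M = k + M + 1 by ring, ← unitNodes_succ', ← ht] at l3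
    rw [unitNodes_succ' (k : ℝ) p, ← ht, Nat.cast_zero, sub_zero, mul_assoc]
    have e' : x * finsetDividedDiff g (insert ((k : ℝ) + x) (insert (k : ℝ) t)) =
        finsetDividedDiff g (insert ((k : ℝ) + x) t) - finsetDividedDiff g (insert (k : ℝ) t) := by
      rw [e]; ring
    rw [e', abs_mul]
    refine mul_le_mul ?_ ?_ (abs_nonneg _) (by positivity)
    · rw [Finset.abs_prod]
      calc ∏ j ∈ Finset.range p, |x - ((j + 1 : ℕ) : ℝ)| ≤ ∏ _j ∈ Finset.range p, (M : ℝ) := by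
            refine Finset.prod_le_prod (fun _ _ => abs_nonneg _) fun j hj => ?_
            have hjp : ((j + 1 : ℕ) : ℝ) ≤ p := by exact_mod_cast Finset.mem_range.1 hj
            have hj0 : (0 : ℝ) ≤ ((j + 1 : ℕ) : ℝ) := Nat.cast_nonneg _
            rw [abs_le]; constructor <;> linarith
        _ = (M : ℝ) ^ p := by simp
    · rw [abs_of_nonneg (by linarith), fwdDiff_iter_eq_finsetDividedDiff,
        fwdDiff_iter_eq_finsetDividedDiff, ← mul_sub, unitNodes_succ' (k : ℝ) p, ← ht]
      have hf : (1 : ℝ) ≤ p.factorial := by exact_mod_cast Nat.one_le_iff_ne_zero.2 p.factorial_ne_zero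
      have hle : finsetDividedDiff g (insert ((k : ℝ) + x) t) - finsetDividedDiff g (insert (k : ℝ) t)
          ≤ finsetDividedDiff g (unitNodes ((k : ℝ) + M) (p + 1)) -
            finsetDividedDiff g (insert (k : ℝ) t) := by linarith
      refine hle.trans (le_mul_of_one_le_left (by linarith) hf)
  -- At an interpolation node the divided difference is not available, but the error itself
  -- vanishes.
  · push Not at hx
    obtain ⟨i, hi, rfl⟩ := hx
    have h0 : eulerTerm p g k i = 0 := by
      have e := shift_eq_sum_fwdDiff_iter (1 : ℝ) g i (k : ℝ)
      rw [nsmul_eq_mul, mul_one] at e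
      rw [eulerTerm, add_comm, e, sub_eq_zero]
      simp only [nsmul_eq_mul, Ring.choose_natCast]
      refine Finset.sum_subset (Finset.range_mono (by omega)) fun j _ hj => ?_
      rw [Nat.choose_eq_zero_of_lt (by simpa using hj)]; simp
    rw [h0, abs_zero]
    exact mul_nonneg (by positivity) (by linarith)

end Bound

/-! ### Uniform convergence of the Eulerian series -/

lemma summable_sub_of_tendsto {φ : ℕ → ℝ} {L : ℝ} (hφ : Tendsto φ atTop (𝓝 L))
    (h : ∀ᶠ n in atTop, φ n ≤ φ (n + 1)) : Summable fun n => φ (n + 1) - φ n := by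
  obtain ⟨N, hN⟩ := eventually_atTop.1 h
  rw [← summable_nat_add_iff N]
  refine ⟨L - φ N, (hasSum_iff_tendsto_nat_of_nonneg ?_ _).2 ?_⟩
  · intro i
    exact sub_nonneg.2 (hN _ (by omega))
  · have e : ∀ n, ∑ i ∈ Finset.range n, (φ (i + N + 1) - φ (i + N)) = φ (n + N) - φ N := by
      intro n
      have := Finset.sum_range_sub (fun i => φ (i + N)) n
      simp only [zero_add] at this
      rw [← this]
      exact Finset.sum_congr rfl fun i _ => by rw [show i + N + 1 = i + 1 + N by omega]
    simp_rw [e]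
    exact ((tendsto_add_atTop_iff_nat N).2 hφ).sub_const _

/-- `Δ^p f(k+M) - Δ^p f(k)` is a sum of `M` consecutive increments of a convergent, eventually
increasing sequence, so it is summable in `k`. -/
lemma InDK.exists_summable_bound {p : ℕ} {g : ℝ → ℝ} (hg : InDK p g) (b : ℝ) :
    ∃ u : ℕ → ℝ, Summable u ∧ ∀ᶠ k in atTop, ∀ x ∈ Ico 0 b, |eulerTerm p g k x| ≤ u k := by
  refine hg.induction (Q := fun f => ∃ u : ℕ → ℝ, Summable u ∧
    ∀ᶠ k in atTop, ∀ x ∈ Ico 0 b, |eulerTerm p f k x| ≤ u k) ?_ ?_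
  · rintro ⟨u, hu, h⟩
    refine ⟨u, hu, h.mono fun k hk x hx => ?_⟩
    have := hk x hx
    rwa [eulerTerm_neg, abs_neg] at this
  · intro f a _ ha hD hc
    obtain ⟨M₀, hM₀⟩ := exists_nat_gt b
    -- `M` exceeds `b`, to cover the interval, and `p`, to separate shifted nodes.
    set M := max M₀ (p + 1) with hMdef
    have hM : p < M := by omega
    have hbM : b < M := hM₀.trans_le (by exact_mod_cast le_max_left _ _)
    set φ : ℕ → ℝ := fun n => (fwdDiff (1 : ℝ))^[p] f n with hφ
    have hev : ∀ᶠ n : ℕ in atTop, a < n :=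
      (tendsto_natCast_atTop_atTop (R := ℝ)).eventually_gt_atTop a
    have hinc : ∀ᶠ n in atTop, φ n ≤ φ (n + 1) := by
      refine hev.mono fun n hn => ?_
      have h1 := convexOfOrderOn_iff.1 hc (unitNodes n (p + 1 + 1)) (card_unitNodes _ _) (by
        intro y hy
        obtain ⟨j, -, rfl⟩ := mem_unitNodes.1 hy
        have hj : (0 : ℝ) ≤ j := j.cast_nonneg
        rw [mem_Ioi]; linarith)
      have h2 := fwdDiff_iter_eq_finsetDividedDiff f (p + 1) n
      rw [Function.iterate_succ_apply', fwdDiff] at h2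
      have h3 : 0 ≤ ((p + 1).factorial : ℝ) * finsetDividedDiff f (unitNodes n (p + 1 + 1)) := by
        positivity
      rw [← h2] at h3
      simp only [hφ]
      push_cast
      linarith
    have hs := summable_sub_of_tendsto (φ := φ) hD hinc
    have hsum : Summable fun k => ∑ i ∈ Finset.range M, (φ (k + i + 1) - φ (k + i)) := by
      refine summable_sum fun i _ => ?_
      exact (summable_nat_add_iff (f := fun n => φ (n + 1) - φ n) i).2 hs
    refine ⟨_, hsum.mul_left ((M : ℝ) ^ p), hev.mono fun k hk x hx => ?_⟩
    refine (hc.abs_eulerTerm_le hk hM hx.1 (hx.2.trans hbM)).trans (le_of_eq ?_)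
    congr 1
    have := Finset.sum_range_sub (fun i => φ (k + i)) M
    simp only [add_zero] at this
    simp only [← add_assoc] at this
    rw [this]
    simp [hφ]

lemma sum_Icc_one_eq_sum_range {M : Type*} [AddCommMonoid M] (f : ℕ → M) (n : ℕ) :
    ∑ k ∈ Finset.Icc 1 n, f k = ∑ k ∈ Finset.range n, f (k + 1) := by
  rw [Finset.range_eq_Ico, Finset.sum_Ico_add' f 0 n 1]
  rfl

/-- The sum of the Eulerian series. -/
noncomputable def eulerSum (p : ℕ) (g : ℝ → ℝ) (x : ℝ) : ℝ := ∑' k, eulerTerm p g (k + 1) x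

/-- Uniform convergence on bounded sets of the Eulerian series. -/
theorem InDK.sumsUniformlyOnBounded {p : ℕ} {g : ℝ → ℝ} (hg : InDK p g) :
    SumsUniformlyOnBounded (Ici 0) (eulerTerm p g) (eulerSum p g) := by
  intro E hE hb
  obtain ⟨b, hb⟩ := hb.bddAbove
  obtain ⟨u, hu, h⟩ := hg.exists_summable_bound (b + 1)
  simp only [sum_Icc_one_eq_sum_range]
  refine tendstoUniformlyOn_tsum_nat_eventually (f := fun k x => eulerTerm p g (k + 1) x)
    ((summable_nat_add_iff 1).2 hu) ?_
  filter_upwards [(tendsto_add_atTop_nat 1).eventually h] with k hk x hx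
  exact hk x ⟨hE hx, by linarith [hb hx]⟩

/-! ### Differentiation and the classes of `p`-convex functions -/

section Derivative

lemma hasDerivAt_fwdDiff_iter {f f' : ℝ → ℝ} (h : ∀ x, 0 < x → HasDerivAt f (f' x) x) (n : ℕ) :
    ∀ x, 0 < x →
      HasDerivAt ((fwdDiff (1 : ℝ))^[n] f) ((fwdDiff (1 : ℝ))^[n] f' x) x := by
  induction n with
  | zero => exact h
  | succ n ih =>
    intro x hx
    rw [Function.iterate_succ_apply', Function.iterate_succ_apply']
    exact ((ih (x + 1) (by linarith)).comp_add_const x 1).sub (ih x hx)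

/-- A divided difference of `g'` is the derivative at `h = 0` of the divided difference of `g` at
the nodes shifted by `h`, and the latter does not fall below its initial value for small `h > 0`. -/
lemma ConvexOfOrderOn.convexOfOrderOn_deriv {p : ℕ} {g : ℝ → ℝ} {a : ℝ} (ha : 0 < a)
    (hg : ConvexOfOrderOn (p + 1) g (Ioi a)) (hd : DifferentiableOn ℝ g (Ioi 0)) :
    ConvexOfOrderOn p (deriv g) (Ioi a) := by
  rw [convexOfOrderOn_iff]
  intro s hs hI
  have hder : HasDerivAt (fun h => ∑ x ∈ s, g (x + h) / ∏ y ∈ s.erase x, (x - y))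
      (finsetDividedDiff (deriv g) s) 0 := by
    unfold finsetDividedDiff
    refine HasDerivAt.fun_sum fun x hx => HasDerivAt.div_const ?_ _
    have hx0 : 0 < x := ha.trans (hI x hx)
    have h1 : HasDerivAt g (deriv g x) (x + 0) := by
      rw [add_zero]
      exact (hd.differentiableAt (Ioi_mem_nhds hx0)).hasDerivAt
    exact h1.comp_const_add x 0
  refine ge_of_tendsto hder.tendsto_slope_zero_right ?_
  -- For small `h > 0` no shifted node meets an original one.
  have hev : ∀ᶠ h in 𝓝[>] (0 : ℝ), ∀ x ∈ s, ∀ y ∈ s, x + h ≠ y := by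
    rw [Finset.eventually_all]
    intro x _
    rw [Finset.eventually_all]
    intro y _
    by_cases hxy : x < y
    · filter_upwards [Ioo_mem_nhdsGT (sub_pos.2 hxy)] with h hh
      have := hh.2
      intro h'
      linarith
    · filter_upwards [self_mem_nhdsWithin] with h hh
      have : 0 < h := hh
      intro h'
      linarith
  filter_upwards [hev, self_mem_nhdsWithin] with h hh (hpos : 0 < h)
  have key := hg.dividedDiff_shift_le hpos s ∅ (by simp [hs]) (by simp)
    (fun x hx => by
      have := mem_Ioi.1 (hI x hx)
      constructor <;> rw [mem_Ioi] <;> linarith)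
    (fun x hx => ⟨by simp, by simp, fun h' => hh x hx _ h' rfl⟩)
  have hinj : Function.Injective fun x : ℝ => x + h := add_left_injective h
  have e : finsetDividedDiff g (s.image (· + h)) =
      ∑ x ∈ s, g (x + h) / ∏ y ∈ s.erase x, (x - y) := by
    unfold finsetDividedDiff
    rw [Finset.sum_image (fun a _ b _ h => hinj h)]
    refine Finset.sum_congr rfl fun x _ => ?_
    rw [← Finset.image_erase hinj, Finset.prod_image (fun a _ b _ h => hinj h)]
    simp
  rw [Finset.empty_union, Finset.empty_union, e] at key
  rw [smul_eq_mul, zero_add]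
  refine mul_nonneg (by positivity) (sub_nonneg.2 ?_)
  simpa [finsetDividedDiff] using key

/-- The mean value theorem gives `Δ^p f'(c) = Δ^(p+1) f(x)` for some `c ∈ (x, x + 1)`. Monotonicity
of `Δ^p f'` then squeezes it between two sequences tending to `0`. -/
theorem InDK.inDK_deriv {p : ℕ} {g : ℝ → ℝ} (hg : InDK (p + 1) g)
    (hd : DifferentiableOn ℝ g (Ioi 0)) : InDK p (deriv g) := by
  refine hg.induction (Q := fun f => InDK p (deriv f)) ?_ ?_
  · rintro ⟨h1, h2⟩
    have e : deriv (-g) = -deriv g := by ext x; simp [deriv.neg]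
    rw [e] at h1 h2
    refine ⟨by simpa using inDNat_neg h1, ?_⟩
    rcases h2 with ⟨a, ha, h⟩ | ⟨a, ha, h⟩
    · exact Or.inr ⟨a, ha, concaveOfOrderOn_iff_neg.2 h⟩
    · exact Or.inl ⟨a, ha, by simpa using concaveOfOrderOn_iff_neg.1 h⟩
  · intro f a hf ha hD hc
    have hdf : DifferentiableOn ℝ f (Ioi 0) := by
      rcases hf with rfl | rfl
      exacts [hd, hd.neg]
    have hc' := hc.convexOfOrderOn_deriv ha hdf
    refine ⟨?_, Or.inl ⟨a, ha, hc'⟩⟩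
    have hder : ∀ x, 0 < x → HasDerivAt f (deriv f x) x := fun x hx =>
      (hdf.differentiableAt (Ioi_mem_nhds hx)).hasDerivAt
    have hD' := hasDerivAt_fwdDiff_iter hder p
    have mvt : ∀ x : ℝ, 0 < x → ∃ c ∈ Ioo x (x + 1),
        (fwdDiff (1 : ℝ))^[p] (deriv f) c = (fwdDiff (1 : ℝ))^[p + 1] f x := by
      intro x hx
      obtain ⟨c, hc, e⟩ := exists_hasDerivAt_eq_slope ((fwdDiff (1 : ℝ))^[p] f)
        ((fwdDiff (1 : ℝ))^[p] (deriv f)) (a := x) (b := x + 1) (by linarith)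
        (fun y hy => (hD' y (by linarith [hy.1])).continuousAt.continuousWithinAt)
        (fun y hy => hD' y (by linarith [hy.1]))
      refine ⟨c, hc, ?_⟩
      rw [e, Function.iterate_succ_apply', fwdDiff]
      simp
    have hev : ∀ᶠ n : ℕ in atTop, a < n :=
      (tendsto_natCast_atTop_atTop (R := ℝ)).eventually_gt_atTop a
    -- The point `n + p + 2` lies between mean value points of `(n, n + 1)` and `(n + 2p + 3, n + 2p
    -- + 4)`, at distance more than `p` from each, as `fwdDiff_iter_le` requires.
    rw [InDNat, ← tendsto_add_atTop_iff_nat (p + 2)]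
    refine tendsto_of_tendsto_of_tendsto_of_le_of_le' hD
      ((tendsto_add_atTop_iff_nat (2 * p + 3)).2 hD) ?_ ?_
    · filter_upwards [hev] with n hn
      obtain ⟨c, hc, e⟩ := mvt n (ha.trans hn)
      rw [← e]
      have := hc'.fwdDiff_iter_le (x := c) (h := n + (p + 2) - c) (hn.trans hc.1)
        (by linarith [hc.2])
      push_cast
      rwa [add_sub_cancel] at this
    · filter_upwards [hev] with n hn
      have hp : (0 : ℝ) ≤ p := p.cast_nonneg
      obtain ⟨c, hc, e⟩ := mvt ((n + (2 * p + 3) : ℕ) : ℝ) (by push_cast; linarith)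
      rw [← e]
      push_cast at hc ⊢
      have := hc'.fwdDiff_iter_le (x := n + (p + 2)) (h := c - (n + (p + 2))) (by linarith)
        (by linarith [hc.1])
      rwa [add_sub_cancel] at this

theorem InDK.inDK_iteratedDeriv {r : ℕ} : ∀ {p : ℕ} {g : ℝ → ℝ}, InDK p g → InC r g → r ≤ p →
    InDK (p - r) (iteratedDeriv r g) := by
  induction r with
  | zero => intro p g hg _ _; simpa using hg
  | succ r ih =>
    intro p g hg hC hr
    obtain ⟨p, rfl⟩ : ∃ q, p = q + 1 := ⟨p - 1, by omega⟩
    have h := (contDiffOn_succ_iff_deriv_of_isOpen isOpen_Ioi).1 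
      (by simpa [InC] using hC)
    rw [iteratedDeriv_succ', Nat.add_sub_add_right]
    exact ih (hg.inDK_deriv h.1) h.2.2 (by omega)

end Derivative

/-! ### Series converging uniformly on bounded sets: integration and differentiation -/

section Sums

variable {A B : Set ℝ} {u v : ℕ → ℝ → ℝ} {S T : ℝ → ℝ}

lemma SumsUniformlyOnBounded.mono (h : SumsUniformlyOnBounded A u S) (hBA : B ⊆ A) :
    SumsUniformlyOnBounded B u S := fun E hE hb => h E (hE.trans hBA) hb

lemma SumsUniformlyOnBounded.congr (h : SumsUniformlyOnBounded A u S)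
    (huv : ∀ k, 1 ≤ k → EqOn (u k) (v k) A) (hST : EqOn S T A) :
    SumsUniformlyOnBounded A v T := fun E hE hb =>
  ((h E hE hb).congr (Eventually.of_forall fun _ _ hx => Finset.sum_congr rfl fun k hk =>
    huv k (Finset.mem_Icc.1 hk).1 (hE hx))).congr_right fun _ hx => hST (hE hx)

lemma SumsUniformlyOnBounded.tendsto (h : SumsUniformlyOnBounded A u S) {x : ℝ} (hx : x ∈ A) :
    Tendsto (fun n => ∑ k ∈ Finset.Icc 1 n, u k x) atTop (𝓝 (S x)) :=
  (h {x} (singleton_subset_iff.2 hx) Bornology.isBounded_singleton).tendsto_at (mem_singleton x)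

lemma SumsUniformlyOnBounded.add (h : SumsUniformlyOnBounded A u S)
    (h' : SumsUniformlyOnBounded A v T) :
    SumsUniformlyOnBounded A (fun k x => u k x + v k x) (fun x => S x + T x) := by
  intro E hE hb
  simp only [Finset.sum_add_distrib]
  exact (h E hE hb).add (h' E hE hb)

lemma sumsUniformlyOnBounded_zero : SumsUniformlyOnBounded A (fun _ _ => 0) (fun _ => 0) := by
  intro E _ _
  simp only [Finset.sum_const_zero]
  exact Metric.tendstoUniformlyOn_iff.2 fun ε hε => Eventually.of_forall fun _ _ _ => by simpa

lemma SumsUniformlyOnBounded.finsetSum {ι : Type*} {s : Finset ι} {u : ι → ℕ → ℝ → ℝ}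
    {S : ι → ℝ → ℝ} (h : ∀ i ∈ s, SumsUniformlyOnBounded A (u i) (S i)) :
    SumsUniformlyOnBounded A (fun k x => ∑ i ∈ s, u i k x) (fun x => ∑ i ∈ s, S i x) := by
  classical
  induction s using Finset.induction_on with
  | empty => simpa using sumsUniformlyOnBounded_zero
  | insert a s ha ih =>
    simp only [Finset.sum_insert ha]
    exact (h a (Finset.mem_insert_self a s)).add
      (ih fun i hi => h i (Finset.mem_insert_of_mem hi))

lemma sumsUniformlyOnBounded_const_mul {c : ℕ → ℝ} {C : ℝ} {b : ℝ → ℝ}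
    (hc : Tendsto (fun n => ∑ k ∈ Finset.Icc 1 n, c k) atTop (𝓝 C)) (hb : Continuous b) :
    SumsUniformlyOnBounded A (fun k x => c k * b x) (fun x => C * b x) := by
  intro E _ hE
  obtain ⟨K, hK⟩ := hE.isCompact_closure.exists_bound_of_continuousOn hb.continuousOn
  rw [Metric.tendstoUniformlyOn_iff]
  intro ε hε
  have hK1 : 0 < |K| + 1 := by positivity
  filter_upwards [Metric.tendsto_nhds.1 hc (ε / (|K| + 1)) (by positivity)] with n hn x hx
  rw [← Finset.sum_mul, dist_comm, Real.dist_eq, ← sub_mul, abs_mul]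
  rw [Real.dist_eq] at hn
  have hbx : |b x| < |K| + 1 := by
    have := hK x (subset_closure hx)
    rw [Real.norm_eq_abs] at this
    linarith [le_abs_self K]
  calc _ ≤ |∑ k ∈ Finset.Icc 1 n, c k - C| * (|K| + 1) := by gcongr
    _ < ε / (|K| + 1) * (|K| + 1) := by gcongr
    _ = ε := by field_simp

lemma SumsUniformlyOnBounded.continuousOn (h : SumsUniformlyOnBounded (Ici 0) u S)
    (hu : ∀ k, 1 ≤ k → ContinuousOn (u k) (Ici 0)) : ContinuousOn S (Ici 0) := by
  intro x hx
  have h1 := h (Icc 0 (x + 1)) Icc_subset_Ici_self (Metric.isBounded_Icc _ _)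
  have h2 : ContinuousOn S (Icc 0 (x + 1)) := h1.continuousOn (Frequently.of_forall fun n =>
    continuousOn_finsetSum _ fun k hk =>
      (hu k (Finset.mem_Icc.1 hk).1).mono Icc_subset_Ici_self)
  refine (h2 x ⟨hx, by linarith⟩).mono_of_mem_nhdsWithin ?_
  rw [mem_nhdsWithin]
  exact ⟨Iio (x + 1), isOpen_Iio, by simp, fun y hy => ⟨hy.2, le_of_lt hy.1⟩⟩

lemma intervalIntegrable_of_continuousOn_Ici {f : ℝ → ℝ} (hf : ContinuousOn f (Ici 0)) {a b : ℝ}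
    (ha : 0 ≤ a) (hb : 0 ≤ b) : IntervalIntegrable f volume a b :=
  (hf.mono fun _ hx => (le_min ha hb).trans hx.1).intervalIntegrable

lemma continuousOn_primitive_Ici {f : ℝ → ℝ} (hf : ContinuousOn f (Ici 0)) {a : ℝ} (ha : 0 ≤ a) :
    ContinuousOn (fun x => ∫ t in a..x, f t) (Ici 0) := by
  -- Extending `f` by `f 0` to the left of `0` gives a globally continuous function with the same
  -- integrals on `[0, ∞)`.
  have hc : Continuous fun x => f (max x 0) :=
    hf.comp_continuous (by fun_prop) fun x => le_max_right x 0
  refine (intervalIntegral.continuous_primitive (μ := volume)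
    (fun a b => hc.intervalIntegrable a b) a).continuousOn.congr fun x hx => ?_
  refine intervalIntegral.integral_congr fun t ht => ?_
  have : 0 ≤ t := (le_min ha hx).trans ht.1
  simp [max_eq_left this]

lemma SumsUniformlyOnBounded.primitive (h : SumsUniformlyOnBounded (Ici 0) u S)
    (hu : ∀ k, 1 ≤ k → ContinuousOn (u k) (Ici 0)) {a : ℝ} (ha : 0 ≤ a) :
    SumsUniformlyOnBounded (Ici 0) (fun k x => ∫ t in a..x, u k t) (fun x => ∫ t in a..x, S t) := by
  have hS := h.continuousOn hu
  intro E hE hb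
  obtain ⟨b, hb⟩ := hb.bddAbove
  set M := max a b with hM
  have hM0 : 0 ≤ M := ha.trans (le_max_left a b)
  rw [Metric.tendstoUniformlyOn_iff]
  intro ε hε
  have h1 := Metric.tendstoUniformlyOn_iff.1
    (h (Icc 0 M) Icc_subset_Ici_self (Metric.isBounded_Icc _ _)) (ε / (M + 1)) (by positivity)
  filter_upwards [h1] with n hn x hx
  have hx0 : 0 ≤ x := hE hx
  have hxM : x ≤ M := (hb hx).trans (le_max_right a b)
  have haM : a ≤ M := le_max_left a b
  have hi : ∀ k ∈ Finset.Icc 1 n, IntervalIntegrable (u k) volume a x := fun k hk =>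
    intervalIntegrable_of_continuousOn_Ici (hu k (Finset.mem_Icc.1 hk).1) ha hx0
  rw [← intervalIntegral.integral_finsetSum hi, Real.dist_eq, ← intervalIntegral.integral_sub
    (intervalIntegrable_of_continuousOn_Ici hS ha hx0) (by
      simpa only [Finset.sum_fn] using IntervalIntegrable.sum _ hi)]
  have h2 : ‖∫ t in a..x, (S t - ∑ k ∈ Finset.Icc 1 n, u k t)‖ ≤ ε / (M + 1) * |x - a| := by
    refine intervalIntegral.norm_integral_le_of_norm_le_const fun t ht => ?_
    have ht' := uIoc_subset_uIcc ht
    have := hn t ⟨(le_min ha hx0).trans ht'.1, ht'.2.trans (max_le haM hxM)⟩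
    exact this.le
  have h3 : |x - a| < M + 1 := by rw [abs_lt]; constructor <;> linarith
  calc _ ≤ ε / (M + 1) * |x - a| := h2
    _ < ε / (M + 1) * (M + 1) := by gcongr
    _ = ε := by field_simp

theorem SumsUniformlyOnBounded.integrableTermwise (h : SumsUniformlyOnBounded (Ici 0) u S)
    (hu : ∀ k, 1 ≤ k → ContinuousOn (u k) (Ici 0)) : IntegrableTermwise u S := by
  refine ⟨hu, h.continuousOn hu, fun l hl => ?_⟩
  -- Continuity of the terms is carried along because each further integration needs it.
  have key : (∀ k, 1 ≤ k → ContinuousOn (iterInt l (u k)) (Ici 0)) ∧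
      SumsUniformlyOnBounded (Ici 0) (fun k => iterInt l (u k)) (iterInt l S) := by
    induction l with
    | nil => exact ⟨hu, h⟩
    | cons a l ih =>
      have ih := ih fun b hb => hl b (List.mem_cons_of_mem a hb)
      have ha := hl a List.mem_cons_self
      exact ⟨fun k hk => continuousOn_primitive_Ici (ih.1 k hk) ha, ih.2.primitive ih.1 ha⟩
  exact key.2

lemma inC_zero_iff {f : ℝ → ℝ} : InC 0 f ↔ ContinuousOn f (Ioi 0) := by
  simp [InC, contDiffOn_zero]

lemma inC_succ_of_hasDerivAt {r : ℕ} {f f' : ℝ → ℝ} (h : ∀ x, 0 < x → HasDerivAt f (f' x) x)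
    (hf' : InC r f') : InC (r + 1) f := by
  have h1 : ContDiffOn ℝ ((r : WithTop ℕ∞) + 1) f (Ioi 0) := by
    rw [contDiffOn_succ_iff_deriv_of_isOpen isOpen_Ioi]
    refine ⟨fun x hx => (h x hx).differentiableAt.differentiableWithinAt, by simp, ?_⟩
    exact ContDiffOn.congr hf' fun x hx => (h x hx).deriv
  simpa [InC] using h1

lemma InC.of_succ {r : ℕ} {f : ℝ → ℝ} (h : InC (r + 1) f) :
    InC r (deriv f) ∧ ∀ x, 0 < x → HasDerivAt f (deriv f x) x := by
  have h1 : ContDiffOn ℝ ((r : WithTop ℕ∞) + 1) f (Ioi 0) := by simpa [InC] using h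
  rw [contDiffOn_succ_iff_deriv_of_isOpen isOpen_Ioi] at h1
  exact ⟨h1.2.2, fun x hx => (h1.1.differentiableAt (Ioi_mem_nhds hx)).hasDerivAt⟩

lemma InC.mono {r s : ℕ} {f : ℝ → ℝ} (h : InC r f) (hs : s ≤ r) : InC s f :=
  ContDiffOn.of_le h (by exact_mod_cast hs)

/-- Uniform convergence of the derived series and convergence of the series itself give `S' = T`;
the higher derivatives are then those of the derived series. -/
lemma DifferentiableTermwise.of_hasDerivAt {r : ℕ}
    (huv : ∀ k, 1 ≤ k → ∀ x, 0 < x → HasDerivAt (u k) (v k x) x)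
    (hS : SumsUniformlyOnBounded (Ioi 0) u S) (hv : DifferentiableTermwise r v T) :
    DifferentiableTermwise (r + 1) u S := by
  obtain ⟨h1, h2, h3⟩ := hv
  have hT : SumsUniformlyOnBounded (Ioi 0) v T := by simpa using h3 0 (Nat.zero_le r)
  have hST : ∀ x, 0 < x → HasDerivAt S (T x) x := by
    intro x hx
    refine hasDerivAt_of_tendstoUniformlyOn (s := Ioo 0 (x + 1)) (l := atTop) isOpen_Ioo
      (hT (Ioo 0 (x + 1)) Ioo_subset_Ioi_self (Metric.isBounded_Ioo _ _))
      (Eventually.of_forall fun n y hy => ?_) (fun y hy => hS.tendsto hy.1) ⟨hx, by linarith⟩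
    exact HasDerivAt.fun_sum fun k hk => huv k (Finset.mem_Icc.1 hk).1 y hy.1
  refine ⟨fun k hk => inC_succ_of_hasDerivAt (huv k hk) (h1 k hk),
    inC_succ_of_hasDerivAt hST h2, fun j hj => ?_⟩
  rcases j with _ | j
  · simpa using hS
  · refine (h3 j (by omega)).congr (fun k hk => ?_) ?_
    · rw [iteratedDeriv_succ']
      exact EqOn.iteratedDeriv_of_isOpen (fun x hx => (huv k hk x hx).deriv.symm) isOpen_Ioi j
    · rw [iteratedDeriv_succ']
      exact EqOn.iteratedDeriv_of_isOpen (fun x hx => (hST x hx).deriv.symm) isOpen_Ioi j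

end Sums

/-! ### Polynomial corrections and term-by-term differentiation -/

section Polynomials

open Polynomial

/-- A pointwise convergent series of polynomials of bounded degree converges, together with its
derivative, uniformly on bounded sets. -/
lemma exists_polynomial_sum {d : ℕ} {q : ℕ → ℝ[X]} (hd : ∀ k, (q k).natDegree ≤ d)
    (h : ∀ x : ℝ, 0 ≤ x → ∃ l, Tendsto (fun n => ∑ k ∈ Finset.Icc 1 n, (q k).eval x) atTop (𝓝 l)) :
    ∃ Q : ℝ[X], (∀ A, SumsUniformlyOnBounded A (fun k x => (q k).eval x) (fun x => Q.eval x)) ∧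
      ∀ A, SumsUniformlyOnBounded A (fun k x => (derivative (q k)).eval x)
        (fun x => (derivative Q).eval x) := by
  -- The values at `0, …, d` determine each polynomial. In the fixed Lagrange basis the series
  -- becomes finitely many convergent number series times fixed polynomials.
  choose l hl using fun i : ℕ => h i i.cast_nonneg
  set s := Finset.range (d + 1)
  set b : ℕ → ℝ[X] := Lagrange.basis s (fun i : ℕ => (i : ℝ))
  have hq : ∀ k, q k = ∑ i ∈ s, C ((q k).eval (i : ℝ)) * b i := by
    intro k
    have := Lagrange.eq_interpolate (s := s) (v := fun i : ℕ => (i : ℝ)) (f := q k)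
      (Nat.cast_injective.injOn) (by
        rw [Finset.card_range]
        exact Polynomial.degree_lt_iff_coeff_zero _ _ |>.2 fun m hm =>
          coeff_eq_zero_of_natDegree_lt (lt_of_le_of_lt (hd k) hm))
    rwa [Lagrange.interpolate_apply] at this
  refine ⟨∑ i ∈ s, C (l i) * b i, fun A => ?_, fun A => ?_⟩
  · have := SumsUniformlyOnBounded.finsetSum (s := s) fun i _ =>
      sumsUniformlyOnBounded_const_mul (A := A) (hl i) (b i).continuous
    refine this.congr (fun k _ x _ => ?_) (fun x _ => ?_)
    · conv_rhs => rw [hq k]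
      simp [eval_finsetSum]
    · simp [eval_finsetSum]
  · have := SumsUniformlyOnBounded.finsetSum (s := s) fun i _ =>
      sumsUniformlyOnBounded_const_mul (A := A) (hl i) (derivative (b i)).continuous
    refine this.congr (fun k _ x _ => ?_) (fun x _ => ?_)
    · conv_rhs => rw [hq k]
      simp [eval_finsetSum]
    · simp [eval_finsetSum]

lemma exists_antiderivative (p : ℝ[X]) :
    ∃ F : ℝ[X], derivative F = p ∧ F.natDegree ≤ p.natDegree + 1 := by
  refine ⟨∑ i ∈ Finset.range (p.natDegree + 1), C (p.coeff i / (i + 1)) * X ^ (i + 1), ?_, ?_⟩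
  · rw [derivative_sum]
    conv_rhs => rw [p.as_sum_range_C_mul_X_pow]
    refine Finset.sum_congr rfl fun i _ => ?_
    rw [derivative_C_mul_X_pow, Nat.add_sub_cancel]
    congr 2
    have : (i : ℝ) + 1 ≠ 0 := by positivity
    push_cast
    field_simp
  · refine natDegree_sum_le_of_forall_le _ _ fun i hi => (natDegree_C_mul_X_pow_le _ _).trans ?_
    exact Finset.mem_range.1 hi

/-- The polynomial `x ↦ x (x - 1) ⋯ (x - j + 1) / j!`. -/
noncomputable def binomPoly (j : ℕ) : ℝ[X] :=
  C ((j.factorial : ℝ)⁻¹) * ∏ i ∈ Finset.range j, (X - C (i : ℝ))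

lemma eval_binomPoly (j : ℕ) (x : ℝ) : (binomPoly j).eval x = Ring.choose x j := by
  rw [ringChoose_real_eq, binomPoly, eval_mul, eval_prod, eval_C, div_eq_inv_mul]
  simp

lemma natDegree_binomPoly_le (j : ℕ) : (binomPoly j).natDegree ≤ j := by
  refine (natDegree_C_mul_le _ _).trans ?_
  rw [natDegree_finsetProd_X_sub_C_eq_card]
  simp

lemma iterate_derivative_binomPoly_of_lt {j p : ℕ} (h : j < p) :
    derivative^[p] (binomPoly j) = 0 :=
  iterate_derivative_eq_zero ((natDegree_binomPoly_le j).trans_lt h)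

lemma iterate_derivative_binomPoly_self (p : ℕ) : derivative^[p] (binomPoly p) = 1 := by
  have hm : (∏ i ∈ Finset.range p, (X - C (i : ℝ))).Monic := monic_prod_X_sub_C _ _
  have hdeg : (∏ i ∈ Finset.range p, (X - C (i : ℝ))).natDegree = p := by
    rw [natDegree_finsetProd_X_sub_C_eq_card]; simp
  have hc : (binomPoly p).coeff p = (p.factorial : ℝ)⁻¹ := by
    rw [binomPoly, coeff_C_mul]
    have := hm.coeff_natDegree
    rw [hdeg] at this
    rw [this, mul_one]
  ext m
  rw [coeff_iterate_derivative]
  rcases m with _ | m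
  · rw [zero_add, hc, Nat.descFactorial_self, coeff_one_zero, nsmul_eq_mul]
    exact mul_inv_cancel₀ (by positivity)
  · rw [coeff_eq_zero_of_natDegree_lt ((natDegree_binomPoly_le p).trans_lt (by omega)), coeff_one]
    simp

lemma iteratedDeriv_polynomial (P : ℝ[X]) (n : ℕ) :
    iteratedDeriv n (fun x => P.eval x) = fun x => (derivative^[n] P).eval x := by
  induction n with
  | zero => simp
  | succ n ih =>
    rw [iteratedDeriv_succ, ih, Function.iterate_succ_apply']
    ext x
    exact Polynomial.deriv _

lemma inC_polynomial (P : ℝ[X]) (r : ℕ) : InC r fun x => P.eval x :=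
  by
  simpa [InC] using (P.contDiff_aeval (n := r) (𝕜 := ℝ)).contDiffOn

/-- The polynomial part of the terms of the Eulerian series. -/
noncomputable def eulerPoly (p : ℕ) (g : ℝ → ℝ) (k : ℕ) : ℝ[X] :=
  ∑ j ∈ Finset.range (p + 1), C ((fwdDiff (1 : ℝ))^[j] g (k : ℝ)) * binomPoly j

lemma eulerTerm_eq (p : ℕ) (g : ℝ → ℝ) (k : ℕ) (x : ℝ) :
    eulerTerm p g k x = g (x + k) - (eulerPoly p g k).eval x := by
  simp [eulerTerm, eulerPoly, eval_finsetSum, eval_binomPoly, mul_comm]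

lemma natDegree_eulerPoly_le (p : ℕ) (g : ℝ → ℝ) (k : ℕ) : (eulerPoly p g k).natDegree ≤ p :=
  natDegree_sum_le_of_forall_le _ _ fun j hj =>
    (natDegree_C_mul_le _ _).trans ((natDegree_binomPoly_le j).trans
      (Nat.lt_succ_iff.1 (Finset.mem_range.1 hj)))

section ShiftSeries

variable {p r d : ℕ} {g S : ℝ → ℝ} {P : ℕ → ℝ[X]}

lemma continuousOn_shift_sub (hg : ContinuousOn g (Ioi 0)) (P : ℝ[X]) {k : ℕ} (hk : 1 ≤ k) :
    ContinuousOn (fun x => g (x + k) - P.eval x) (Ici 0) := by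
  refine ContinuousOn.sub (hg.comp (by fun_prop) fun x hx => ?_) P.continuous.continuousOn
  have hk' : (1 : ℝ) ≤ k := by exact_mod_cast hk
  have hx' : (0 : ℝ) ≤ x := hx
  rw [mem_Ioi]; linarith

/-- If the series `∑ (g(x+k) - P_k(x))`, with polynomials `P_k` of bounded degree, converges
pointwise, then it converges uniformly on bounded sets. -/
theorem InDK.sumsUniformlyOnBounded_shift (hg : InDK p g) (hP : ∀ k, (P k).natDegree ≤ d)
    (h : ∀ x, 0 ≤ x →
      Tendsto (fun n : ℕ => ∑ k ∈ Finset.Icc 1 n, (g (x + k) - (P k).eval x)) atTop (𝓝 (S x))) :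
    SumsUniformlyOnBounded (Ici 0) (fun (k : ℕ) x => g (x + k) - (P k).eval x) S := by
  have h0 := hg.sumsUniformlyOnBounded
  -- The given series and the Eulerian one differ by polynomials of bounded degree, so pointwise
  -- convergence of the difference is already uniform.
  obtain ⟨Q, hQ, -⟩ := exists_polynomial_sum (q := fun k => eulerPoly p g k - P k) (d := max p d)
    (fun k => (natDegree_sub_le _ _).trans (max_le_max (natDegree_eulerPoly_le p g k) (hP k)))
    (fun x hx => by
      refine ⟨_, ((h x hx).sub (h0.tendsto hx)).congr fun n => ?_⟩
      rw [← Finset.sum_sub_distrib]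
      refine Finset.sum_congr rfl fun k _ => ?_
      rw [eulerTerm_eq, eval_sub]; ring)
  have h1 := (h0.add (hQ (Ici 0))).congr (v := fun (k : ℕ) x => g (x + k) - (P k).eval x)
    (fun k _ x _ => by simp only [eulerTerm_eq, eval_sub]; ring) (eqOn_refl _ _)
  exact h1.congr (fun _ _ => eqOn_refl _ _) fun x hx =>
    tendsto_nhds_unique (h1.tendsto hx) (h x hx)

/-- Differentiability term by term of a series `∑ (g(x+k) - P_k(x))`. -/
theorem InDK.differentiableTermwise_shift : ∀ {r p d : ℕ} {g S : ℝ → ℝ} {P : ℕ → ℝ[X]},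
    InDK p g → InC r g → r ≤ p → (∀ k, (P k).natDegree ≤ d) →
    (∀ x, 0 ≤ x →
      Tendsto (fun n : ℕ => ∑ k ∈ Finset.Icc 1 n, (g (x + k) - (P k).eval x)) atTop (𝓝 (S x))) →
    DifferentiableTermwise r (fun (k : ℕ) x => g (x + k) - (P k).eval x) S := by
  intro r
  induction r with
  | zero =>
    intro p d g S P hg hC _ hP h
    have h1 := hg.sumsUniformlyOnBounded_shift hP h
    have hu : ∀ k : ℕ, 1 ≤ k → ContinuousOn (fun x => g (x + k) - (P k).eval x) (Ici 0) :=
      fun k hk => continuousOn_shift_sub (inC_zero_iff.1 hC) (P k) hk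
    refine ⟨fun k hk => inC_zero_iff.2 ((hu k hk).mono Ioi_subset_Ici_self),
      inC_zero_iff.2 ((h1.continuousOn hu).mono Ioi_subset_Ici_self), fun j hj => ?_⟩
    obtain rfl : j = 0 := by omega
    simpa using h1.mono Ioi_subset_Ici_self
  | succ r ih =>
    intro p d g S P hg hC hr hP h
    obtain ⟨p, rfl⟩ : ∃ q, p = q + 1 := ⟨p - 1, by omega⟩
    obtain ⟨hC', hder⟩ := hC.of_succ
    have hg' : InDK p (deriv g) := hg.inDK_deriv fun x hx =>
      (hder x hx).differentiableAt.differentiableWithinAt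
    have hcont : ContinuousOn (deriv g) (Ioi 0) := inC_zero_iff.1 (hC'.mono (Nat.zero_le r))
    have hu : ∀ k, 1 ≤ k → ContinuousOn (eulerTerm p (deriv g) k) (Ici 0) := fun k hk =>
      (continuousOn_shift_sub hcont (eulerPoly p (deriv g) k) hk).congr
        fun x _ => eulerTerm_eq p (deriv g) k x
    have h0 := hg'.sumsUniformlyOnBounded
    have h1 := h0.primitive hu le_rfl
    -- Integrating the Eulerian terms of `g'` from `0` recovers `g (x + k)` up to a polynomial.
    choose F hF hFdeg using fun k => exists_antiderivative (eulerPoly p (deriv g) k)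
    have hint : ∀ k, 1 ≤ k → ∀ x, 0 ≤ x → ∫ t in (0 : ℝ)..x, eulerTerm p (deriv g) k t =
        g (x + k) - (F k).eval x - (g k - (F k).eval 0) := by
      intro k hk x hx
      have hk' : (1 : ℝ) ≤ k := by exact_mod_cast hk
      rw [intervalIntegral.integral_eq_sub_of_hasDerivAt (f := fun t => g (t + k) - (F k).eval t)]
      · simp
      · intro t ht
        have ht0 : 0 ≤ t := by simpa [hx] using ht.1
        rw [eulerTerm_eq, ← hF k]
        exact ((hder (t + k) (by linarith)).comp_add_const t k).sub ((F k).hasDerivAt t)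
      · exact intervalIntegrable_of_continuousOn_Ici (hu k hk) le_rfl hx
    -- The polynomials separating the given terms from the integrated ones form a pointwise
    -- convergent series. Its derived series, added to the Eulerian series of `g'`, is the derived
    -- series sought.
    obtain ⟨Q, -, hQ⟩ := exists_polynomial_sum
      (q := fun k => F k + C (g k - (F k).eval 0) - P k) (d := max (p + 1) d)
      (fun k => by
        refine (natDegree_sub_le _ _).trans (max_le_max ?_ (hP k))
        refine (natDegree_add_le _ _).trans (max_le ((hFdeg k).trans ?_) (by simp))
        exact Nat.succ_le_succ (natDegree_eulerPoly_le p (deriv g) k))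
      (fun x hx => by
        refine ⟨_, ((h x hx).sub (h1.tendsto hx)).congr fun n => ?_⟩
        rw [← Finset.sum_sub_distrib]
        refine Finset.sum_congr rfl fun k hk => ?_
        rw [hint k (Finset.mem_Icc.1 hk).1 x hx]
        simp only [eval_sub, eval_add, eval_C]; ring)
    have h2 := (h0.add (hQ (Ici 0))).congr
      (v := fun k x => deriv g (x + k) - (derivative (P k)).eval x)
      (fun k _ x _ => by
        simp only [eulerTerm_eq, derivative_sub, derivative_add, derivative_C, hF, eval_sub,
          eval_add, eval_zero]
        ring) (eqOn_refl _ _)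
    -- The derived series again has the form `g' (x + k)` minus polynomials of degree at most `d`;
    -- allowing arbitrary such polynomials is what lets the induction close.
    have h3 := ih hg' hC' (by omega) (P := fun k => derivative (P k)) (d := d)
      (fun k => (natDegree_derivative_le (P k)).trans ((Nat.sub_le _ _).trans (hP k)))
      (fun x hx => h2.tendsto hx)
    refine DifferentiableTermwise.of_hasDerivAt (fun k _ x hx => ?_)
      ((hg.sumsUniformlyOnBounded_shift hP h).mono Ioi_subset_Ici_self) h3
    have hk0 : (0 : ℝ) ≤ k := k.cast_nonneg
    exact ((hder (x + k) (by linarith)).comp_add_const x k).sub ((P k).hasDerivAt x)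

end ShiftSeries

end Polynomials

/-! ### The operator `Σ`: independence of `p` and the difference equation -/

section Sigma

variable {p q r : ℕ} {g : ℝ → ℝ} {x : ℝ}

lemma InDNat.mono (h : InDNat p g) (hpq : p ≤ q) : InDNat q g := by
  induction q, hpq using Nat.le_induction with
  | base => exact h
  | succ q _ ih =>
    have h1 := ((tendsto_add_atTop_iff_nat 1).2 ih).sub ih
    rw [sub_zero] at h1
    refine h1.congr fun n => ?_
    rw [Function.iterate_succ_apply', fwdDiff]
    push_cast
    rfl

lemma InDK.of_inK (h : InDK p g) (hpq : p ≤ q) (hq : InK q g) : InDK q g :=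
  ⟨h.1.mono hpq, hq⟩

/-- Since `Δ^(j-1) g(n+1) = Δ^(j-1) g(n) + Δ^j g(n)`, passing from `n` to `n + 1` subtracts exactly
one Eulerian term. -/
lemma gaussSeq_succ_eq (p n : ℕ) (g : ℝ → ℝ) (x : ℝ) :
    gaussSeq p (n + 1) g x =
      -g x + ∑ j ∈ Finset.Icc 1 p, Ring.choose x j * (fwdDiff (1 : ℝ))^[j - 1] g 1 -
        ∑ k ∈ Finset.Icc 1 n, eulerTerm p g k x := by
  induction n with
  | zero => simp [gaussSeq]
  | succ n ih =>
    rw [Finset.sum_Icc_succ_top (by omega), ← sub_sub, ← ih]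
    unfold gaussSeq
    rw [Finset.sum_Ico_succ_top (by omega), eulerTerm, Finset.sum_range_succ']
    simp only [sum_Icc_one_eq_sum_range, Nat.add_sub_cancel]
    have e : ∀ j, Ring.choose x (j + 1) * (fwdDiff (1 : ℝ))^[j] g ((n + 1 + 1 : ℕ) : ℝ) =
        Ring.choose x (j + 1) * (fwdDiff (1 : ℝ))^[j] g ((n + 1 : ℕ) : ℝ) +
        Ring.choose x (j + 1) * (fwdDiff (1 : ℝ))^[j + 1] g ((n + 1 : ℕ) : ℝ) := by
      intro j
      rw [Function.iterate_succ_apply', fwdDiff]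
      push_cast
      ring
    simp only [e, Finset.sum_add_distrib]
    simp
    ring

lemma InDK.tendsto_gaussSeq (hg : InDK p g) (hx : 0 ≤ x) :
    Tendsto (fun n => gaussSeq p n g x) atTop
      (𝓝 (-g x + ∑ j ∈ Finset.Icc 1 p, Ring.choose x j * (fwdDiff (1 : ℝ))^[j - 1] g 1 -
        eulerSum p g x)) := by
  rw [← tendsto_add_atTop_iff_nat 1]
  simp only [gaussSeq_succ_eq]
  exact (hg.sumsUniformlyOnBounded.tendsto hx).const_sub _

/-- Raising `q` by one adds `C(x, q+1) Δ^q g(n) → 0`. Hence `Sig`, defined with the least order, is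
the limit for every admissible order. -/
lemma InDNat.tendsto_gaussSeq_of_le (hg : InDNat p g) (hpq : p ≤ q) {l : ℝ}
    (h : Tendsto (fun n => gaussSeq p n g x) atTop (𝓝 l)) :
    Tendsto (fun n => gaussSeq q n g x) atTop (𝓝 l) := by
  induction q, hpq using Nat.le_induction with
  | base => exact h
  | succ q hq ih =>
    have h1 := ih.add ((hg.mono hq).const_mul (Ring.choose x (q + 1)))
    rw [mul_zero, add_zero] at h1
    refine h1.congr fun n => ?_
    unfold gaussSeq
    rw [Finset.sum_Icc_succ_top (by omega), Nat.add_sub_cancel, ← add_assoc]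

lemma InDK.tendsto_gaussSeq_sig (hg : InDK p g) (hx : 0 ≤ x) :
    Tendsto (fun n => gaussSeq p n g x) atTop (𝓝 (Sig g x)) := by
  classical
  have h : ∃ p, InDK p g := ⟨p, hg⟩
  have h1 := (Nat.find_spec h).tendsto_gaussSeq hx
  have h2 : Sig g x = limUnder atTop (fun n : ℕ => gaussSeq (Nat.find h) n g x) := by
    unfold Sig
    rw [dif_pos h]
  rw [h2, h1.limUnder_eq]
  exact (Nat.find_spec h).1.tendsto_gaussSeq_of_le (Nat.find_min' h hg) h1

lemma InDK.sig_eq (hg : InDK p g) (hx : 0 ≤ x) :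
    Sig g x = -g x + ∑ j ∈ Finset.Icc 1 p, Ring.choose x j * (fwdDiff (1 : ℝ))^[j - 1] g 1 -
      eulerSum p g x :=
  tendsto_nhds_unique (hg.tendsto_gaussSeq_sig hx) (hg.tendsto_gaussSeq hx)

lemma InDK.tendsto_eulerTerm (hg : InDK p g) (hx : 0 ≤ x) :
    Tendsto (fun n => eulerTerm p g n x) atTop (𝓝 0) := by
  have h := hg.sumsUniformlyOnBounded.tendsto hx
  have h1 := ((tendsto_add_atTop_iff_nat 1).2 h).sub h
  rw [sub_self] at h1
  rw [← tendsto_add_atTop_iff_nat 1]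
  refine h1.congr fun n => ?_
  rw [Finset.sum_Icc_succ_top (by omega)]
  ring

/-- `Σg` solves the difference equation `Δf = g`. -/
theorem InDK.sig_add_one (hg : InDK p g) (hx : 0 ≤ x) : Sig g (x + 1) = Sig g x + g x := by
  have h1 := hg.tendsto_gaussSeq_sig (x := x + 1) (by linarith)
  -- By Pascal's rule the sequence at `x + 1` is the one at `x` plus `g x`, up to the `n`-th
  -- Eulerian term and `C(x,p) Δ^p g(n)`, both of which vanish in the limit.
  have h2 := ((hg.tendsto_gaussSeq_sig hx).add_const (g x)).sub ((hg.tendsto_eulerTerm hx).add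
    (hg.1.const_mul (Ring.choose x p)))
  rw [mul_zero, add_zero, sub_zero] at h2
  refine tendsto_nhds_unique h1 (h2.congr' ?_)
  filter_upwards [eventually_ge_atTop 1] with n hn
  obtain ⟨n, rfl⟩ : ∃ m, n = m + 1 := ⟨n - 1, by omega⟩
  unfold gaussSeq
  rw [eulerTerm, Finset.sum_range_succ]
  simp only [sum_Icc_one_eq_sum_range, Nat.add_sub_cancel, Ring.choose_succ_succ, add_mul,
    Finset.sum_add_distrib, Finset.sum_sub_distrib]
  have e := Finset.sum_Ico_sub (fun k : ℕ => g (x + k)) hn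
  have e' : ∑ k ∈ Finset.Ico 1 (n + 1), g (x + 1 + k) =
      ∑ k ∈ Finset.Ico 1 (n + 1), g (x + (k + 1 : ℕ)) :=
    Finset.sum_congr rfl fun k _ => by push_cast; congr 1; ring
  rw [Finset.sum_sub_distrib] at e
  rw [e']
  push_cast at e ⊢
  linarith

end Sigma

/-! ### The Eulerian form -/

section Eulerian

open Polynomial

variable {p r : ℕ} {g : ℝ → ℝ}

lemma eulerTerm_eq_shift (p : ℕ) (g : ℝ → ℝ) :
    eulerTerm p g = fun (k : ℕ) x => g (x + k) - (eulerPoly p g k).eval x := by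
  ext k x
  exact eulerTerm_eq p g k x

lemma continuousOn_eulerTerm (hg : InC 0 g) {k : ℕ} (hk : 1 ≤ k) :
    ContinuousOn (eulerTerm p g k) (Ici 0) := by
  rw [eulerTerm_eq_shift]
  exact continuousOn_shift_sub (inC_zero_iff.1 hg) _ hk

/-- The terms keep order `p` while `g` is placed in the class of order `max p r`; the subtracted
polynomials only need bounded degree. -/
lemma InDK.differentiableTermwise_eulerTerm (hg : InDK p g) (hC : InC r g)
    (hK : InK (max p r) g) : DifferentiableTermwise r (eulerTerm p g) (eulerSum p g) := by
  have h := fun x (hx : x ∈ Ici (0 : ℝ)) => hg.sumsUniformlyOnBounded.tendsto hx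
  rw [eulerTerm_eq_shift] at h ⊢
  exact (hg.of_inK (le_max_left p r) hK).differentiableTermwise_shift hC (le_max_right p r)
    (natDegree_eulerPoly_le p g) h

/-- The polynomial part of the Eulerian form of `Σg`. -/
noncomputable def sigPoly (p : ℕ) (g : ℝ → ℝ) : ℝ[X] :=
  ∑ j ∈ Finset.range p, C ((fwdDiff (1 : ℝ))^[j] g 1) * binomPoly (j + 1)

lemma InDK.sig_eqOn (hg : InDK p g) :
    EqOn (Sig g) (fun x => -g x + (sigPoly p g).eval x - eulerSum p g x) (Ici 0) := by
  intro x hx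
  rw [hg.sig_eq hx, sum_Icc_one_eq_sum_range]
  simp [sigPoly, eval_finsetSum, eval_binomPoly, mul_comm]

lemma InDK.inC_sig (hg : InDK p g) (hC : InC r g) (hK : InK (max p r) g) : InC r (Sig g) := by
  have h := (hg.differentiableTermwise_eulerTerm hC hK).2.1
  exact ((ContDiffOn.neg hC).add (inC_polynomial (sigPoly p g) r) |>.sub h).congr
    (hg.sig_eqOn.mono Ioi_subset_Ici_self)

end Eulerian

/-! ### The Weierstrassian form in degree `-1` -/

section Weierstrass

variable {p r : ℕ} {g : ℝ → ℝ}

/-- For order `0` the Eulerian term is `g (x + k) - g k`, so the summable bound controls `g x - g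
⌊x⌋` and carries the limit from the integers to the reals. -/
lemma InDK.inDReal_zero (hg : InDK 0 g) : InDReal 0 g := by
  obtain ⟨u, hu, h⟩ := hg.exists_summable_bound 1
  have h1 : Tendsto (fun n : ℕ => g n) atTop (𝓝 0) := hg.1
  have h2 := (h1.abs.add hu.tendsto_atTop_zero).comp (tendsto_nat_floor_atTop (α := ℝ))
  rw [abs_zero, add_zero] at h2
  refine squeeze_zero_norm' ?_ h2
  filter_upwards [(tendsto_nat_floor_atTop (α := ℝ)).eventually h, eventually_ge_atTop 0]
    with x hx hx0
  have h3 := hx (x - ⌊x⌋₊) ⟨sub_nonneg.2 (Nat.floor_le hx0), by linarith [Nat.lt_floor_add_one x]⟩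
  simp only [eulerTerm, zero_add, Finset.sum_range_one, Ring.choose_zero_right, one_mul,
    Function.iterate_zero, id, sub_add_cancel] at h3
  simp only [Function.iterate_zero, id, Real.norm_eq_abs, Function.comp]
  have := abs_sub_abs_le_abs_sub (g x) (g ⌊x⌋₊)
  linarith

lemma InDK.succDeg_eq_zero (hg : InDK 0 g) : succDeg g = 0 :=
  Nat.sInf_eq_zero.2 (Or.inl hg.inDReal_zero)

lemma InDK.sig_add_one_eq_neg_eulerSum (hg : InDK 0 g) {x : ℝ} (hx : 0 ≤ x) :
    Sig g (x + 1) = -eulerSum 0 g x := by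
  rw [hg.sig_add_one hx, hg.sig_eq hx]
  simp
  ring

lemma InDK.asympConst_eq (hg : InDK 0 g) : asympConst g = -∫ t in (0 : ℝ)..1, eulerSum 0 g t := by
  rw [asympConst, ← intervalIntegral.integral_neg]
  refine intervalIntegral.integral_congr fun t ht => hg.sig_add_one_eq_neg_eulerSum ?_
  simpa using ht.1

lemma InDK.tendsto_sum_integral_eulerTerm (hg : InDK 0 g) (hC : InC 0 g) :
    Tendsto (fun n => ∑ k ∈ Finset.Icc 1 n, -∫ t in (0 : ℝ)..1, eulerTerm 0 g k t) atTop
      (𝓝 (asympConst g)) := by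
  rw [hg.asympConst_eq]
  simp only [Finset.sum_neg_distrib]
  exact ((hg.sumsUniformlyOnBounded.primitive (fun k hk => continuousOn_eulerTerm hC hk)
    le_rfl).tendsto (x := 1) (by simp)).neg

/-- The generalized Euler constant exists and is the asymptotic constant, in degree `-1`. -/
theorem InDK.hasEulerConst (hg : InDK 0 g) (hC : InC 0 g) :
    HasEulerConst g ∧ eulerConst g = asympConst g := by
  have h : Tendsto (fun n : ℕ => -gregoryRem (succDeg g) 1 n g) atTop (𝓝 (asympConst g)) := by
    rw [hg.succDeg_eq_zero, ← tendsto_add_atTop_iff_nat 1]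
    refine (hg.tendsto_sum_integral_eulerTerm hC).congr fun n => ?_
    rw [Finset.sum_neg_distrib, ← intervalIntegral.integral_finsetSum fun k hk =>
      intervalIntegrable_of_continuousOn_Ici
        (continuousOn_eulerTerm hC (Finset.mem_Icc.1 hk).1) le_rfl zero_le_one]
    -- `rho 1` unfolds to `eulerTerm 0`, and `Ico 1 (n + 1)` to `Icc 1 n`.
    rfl
  have h' : eulerConst g = asympConst g := h.limUnder_eq
  exact ⟨by rw [HasEulerConst, h']; exact h, h'⟩

lemma weierTermZero_eq (hC : InC 0 g) {k : ℕ} (hk : 1 ≤ k) (x : ℝ) :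
    weierTermZero g k x = eulerTerm 0 g k x + -∫ t in (0 : ℝ)..1, eulerTerm 0 g k t := by
  have hk' : (1 : ℝ) ≤ k := by exact_mod_cast hk
  have e : ∀ t, eulerTerm 0 g k t = g (t + k) - g k := by simp [eulerTerm]
  have hi : IntervalIntegrable (fun t => g (t + k)) volume 0 1 := by
    refine intervalIntegrable_of_continuousOn_Ici ?_ le_rfl zero_le_one
    refine (inC_zero_iff.1 hC).comp (by fun_prop) fun x hx => ?_
    have hx' : (0 : ℝ) ≤ x := hx
    rw [mem_Ioi]; linarith
  simp only [e]
  rw [intervalIntegral.integral_sub hi intervalIntegrable_const, weierTermZero,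
    intervalIntegral.integral_comp_add_right]
  simp [add_comm (k : ℝ) 1]

lemma weierTermZero_eq_shift (g : ℝ → ℝ) :
    weierTermZero g = fun (k : ℕ) x =>
      g (x + k) - (Polynomial.C (∫ t in (k : ℝ)..(k + 1), g t)).eval x := by
  ext k x
  simp [weierTermZero]

lemma InDK.sumsUniformlyOnBounded_weierTermZero (hg : InDK 0 g) (hC : InC 0 g) :
    SumsUniformlyOnBounded (Ici 0) (weierTermZero g) fun x => eulerSum 0 g x + asympConst g :=
  (hg.sumsUniformlyOnBounded.add (sumsUniformlyOnBounded_const_mul (b := fun _ => 1)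
    (hg.tendsto_sum_integral_eulerTerm hC) continuous_const)).congr
    (fun k hk x _ => by simp only [weierTermZero_eq hC hk x, mul_one])
    (fun x _ => by simp only [mul_one])

lemma InDK.differentiableTermwise_weierTermZero (hg : InDK 0 g) (hC : InC r g) (hK : InK r g) :
    DifferentiableTermwise r (weierTermZero g) fun x => eulerSum 0 g x + asympConst g := by
  have h := fun x (hx : x ∈ Ici (0 : ℝ)) =>
    (hg.sumsUniformlyOnBounded_weierTermZero (hC.mono (Nat.zero_le r))).tendsto hx
  rw [weierTermZero_eq_shift] at h ⊢
  exact (hg.of_inK (Nat.zero_le r) hK).differentiableTermwise_shift hC le_rfl (d := 0)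
    (fun k => by simp) h

end Weierstrass

/-! ### The Weierstrassian form in degree `p - 1 ≥ 0` -/

section WeierstrassHigher

open Polynomial

variable {p r : ℕ} {g : ℝ → ℝ}

lemma InC.hasDerivAt_iteratedDeriv (hC : InC (r + 1) g) {x : ℝ} (hx : 0 < x) :
    HasDerivAt (iteratedDeriv r g) (iteratedDeriv (r + 1) g x) x := by
  induction r generalizing g with
  | zero => simpa using hC.of_succ.2 x hx
  | succ r ih =>
    have := ih hC.of_succ.1
    rwa [← iteratedDeriv_succ', ← iteratedDeriv_succ'] at this

lemma InC.inC_iteratedDeriv (hC : InC r g) : InC 0 (iteratedDeriv r g) := by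
  induction r generalizing g with
  | zero => simpa using hC
  | succ r ih => rw [iteratedDeriv_succ']; exact ih hC.of_succ.1

lemma InC.contDiffAt (hC : InC r g) {x : ℝ} (hx : 0 < x) : ContDiffAt ℝ r g x :=
  ContDiffOn.contDiffAt hC (Ioi_mem_nhds hx)

lemma contDiffAt_polynomial (P : ℝ[X]) (r : ℕ) (x : ℝ) :
    ContDiffAt ℝ r (fun x => P.eval x) x := by
  simpa using (P.contDiff_aeval (n := r) (𝕜 := ℝ)).contDiffAt (x := x)

lemma iterate_derivative_eulerPoly (p : ℕ) (g : ℝ → ℝ) (k : ℕ) :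
    derivative^[p] (eulerPoly p g k) = C ((fwdDiff (1 : ℝ))^[p] g k) := by
  rw [eulerPoly, iterate_derivative_sum, Finset.sum_range_succ, Finset.sum_eq_zero, zero_add,
    iterate_derivative_C_mul, iterate_derivative_binomPoly_self, mul_one]
  intro j hj
  rw [iterate_derivative_C_mul, iterate_derivative_binomPoly_of_lt (Finset.mem_range.1 hj),
    mul_zero]

lemma iterate_derivative_sigPoly (p : ℕ) (g : ℝ → ℝ) :
    derivative^[p + 1] (sigPoly (p + 1) g) = C ((fwdDiff (1 : ℝ))^[p] g 1) := by
  rw [sigPoly, iterate_derivative_sum, Finset.sum_range_succ, Finset.sum_eq_zero, zero_add,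
    iterate_derivative_C_mul, iterate_derivative_binomPoly_self, mul_one]
  intro j hj
  rw [iterate_derivative_C_mul, iterate_derivative_binomPoly_of_lt
    (Nat.succ_lt_succ (Finset.mem_range.1 hj)), mul_zero]

lemma iteratedDeriv_eulerTerm (hC : InC p g) (k : ℕ) {x : ℝ} (hx : 0 < x) :
    iteratedDeriv p (eulerTerm p g k) x =
      iteratedDeriv p g (x + k) - (fwdDiff (1 : ℝ))^[p] g k := by
  have hk : (0 : ℝ) ≤ k := k.cast_nonneg
  have h1 : ContDiffAt ℝ p (fun x => g (x + k)) x :=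
    ContDiffAt.comp (g := g) x (hC.contDiffAt (by linarith)) (by fun_prop)
  rw [eulerTerm_eq_shift, iteratedDeriv_fun_sub h1 (contDiffAt_polynomial _ _ _),
    iteratedDeriv_comp_add_const, iteratedDeriv_polynomial, iterate_derivative_eulerPoly]
  simp

lemma InDK.inDK_zero_iteratedDeriv (hg : InDK p g) (hC : InC p g) :
    InDK 0 (iteratedDeriv p g) := by
  simpa using hg.inDK_iteratedDeriv hC le_rfl

/-- The sum of the series `∑ (Δ^p g(k) - g^{(p)}(k))`. -/
noncomputable def diffDerivSum (p : ℕ) (g : ℝ → ℝ) : ℝ :=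
  eulerSum 0 (iteratedDeriv p g) 1 - iteratedDeriv p (eulerSum p g) 1

/-- The `p`-th derivative of an Eulerian term is `g^{(p)}(x+k) - Δ^p g(k)`, while the order-`0` term
of `g^{(p)}` is `g^{(p)}(x+k) - g^{(p)}(k)`. Both series converge, and their difference has terms
free of `x`. -/
lemma InDK.tendsto_sum_fwdDiff_sub_deriv (hg : InDK p g) (hC : InC p g) {x : ℝ} (hx : 0 < x) :
    Tendsto (fun n : ℕ => ∑ k ∈ Finset.Icc 1 n,
      ((fwdDiff (1 : ℝ))^[p] g (k : ℝ) - iteratedDeriv p g (k : ℝ))) atTop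
      (𝓝 (eulerSum 0 (iteratedDeriv p g) x - iteratedDeriv p (eulerSum p g) x)) := by
  have h1 := (hg.inDK_zero_iteratedDeriv hC).sumsUniformlyOnBounded.tendsto hx.le
  have h2 := ((hg.differentiableTermwise_eulerTerm hC (by simpa using hg.2)).2.2 p le_rfl).tendsto
    (mem_Ioi.2 hx)
  refine (h1.sub h2).congr fun n => ?_
  rw [← Finset.sum_sub_distrib]
  refine Finset.sum_congr rfl fun k _ => ?_
  rw [iteratedDeriv_eulerTerm hC k hx]
  simp [eulerTerm]

lemma InDK.iteratedDeriv_eulerSum (hg : InDK p g) (hC : InC p g) {x : ℝ} (hx : 0 < x) :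
    iteratedDeriv p (eulerSum p g) x = eulerSum 0 (iteratedDeriv p g) x - diffDerivSum p g := by
  have := tendsto_nhds_unique (hg.tendsto_sum_fwdDiff_sub_deriv hC hx)
    (hg.tendsto_sum_fwdDiff_sub_deriv hC one_pos)
  rw [diffDerivSum]
  linarith

/-- `(Σg)^{(p)}` and `Σ(g^{(p)})` differ by a constant. -/
lemma InDK.iteratedDeriv_sig (hg : InDK (p + 1) g) (hC : InC (p + 1) g) {x : ℝ} (hx : 0 < x) :
    iteratedDeriv (p + 1) (Sig g) x = Sig (iteratedDeriv (p + 1) g) x +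
      ((fwdDiff (1 : ℝ))^[p] g 1 + diffDerivSum (p + 1) g) := by
  have hS : InC (p + 1) (eulerSum (p + 1) g) :=
    (hg.differentiableTermwise_eulerTerm hC (by simpa using hg.2)).2.1
  have e := (hg.sig_eqOn.mono Ioi_subset_Ici_self).iteratedDeriv_of_isOpen isOpen_Ioi (p + 1)
    (mem_Ioi.2 hx)
  have hgx := hC.contDiffAt hx
  have hP := contDiffAt_polynomial (sigPoly (p + 1) g) (p + 1) x
  rw [e, iteratedDeriv_fun_sub (hgx.neg.add hP) (hS.contDiffAt hx),
    iteratedDeriv_fun_add hgx.neg hP, iteratedDeriv_fun_neg, iteratedDeriv_polynomial,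
    iterate_derivative_sigPoly]
  beta_reduce
  rw [eval_C, hg.iteratedDeriv_eulerSum hC hx,
    (hg.inDK_zero_iteratedDeriv hC).sig_eq hx.le]
  simp
  ring

lemma InDK.sig_one (hg : InDK 0 g) : Sig g 1 = 0 := by
  have := hg.sig_add_one_eq_neg_eulerSum le_rfl
  rw [zero_add] at this
  rw [this]
  simp [eulerSum, eulerTerm]

lemma InDK.iteratedDeriv_sig_one (hg : InDK (p + 1) g) (hC : InC (p + 1) g) :
    iteratedDeriv (p + 1) (Sig g) 1 = (fwdDiff (1 : ℝ))^[p] g 1 + diffDerivSum (p + 1) g := by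
  rw [hg.iteratedDeriv_sig hC one_pos, (hg.inDK_zero_iteratedDeriv hC).sig_one, zero_add]

/-- `Σ(g^{(p+1)})` is `(Σg)^{(p+1)}` minus its value at `1`. Its integral over `[1, 2]` is an
increment of `(Σg)^{(p)}`, which the differentiated equation `ΔΣg = g` evaluates as `g^{(p)}(1)`. -/
theorem InDK.asympConst_iteratedDeriv (hg : InDK (p + 1) g) (hC : InC (p + 1) g) :
    asympConst (iteratedDeriv (p + 1) g) =
      iteratedDeriv p g 1 - iteratedDeriv (p + 1) (Sig g) 1 := by
  have hf : InC (p + 1) (Sig g) := hg.inC_sig hC (by simpa using hg.2)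
  have hcont := inC_zero_iff.1 hf.inC_iteratedDeriv
  have hi : IntervalIntegrable (fun t => iteratedDeriv (p + 1) (Sig g) (t + 1)) volume 0 1 := by
    refine intervalIntegrable_of_continuousOn_Ici ?_ le_rfl zero_le_one
    refine hcont.comp (by fun_prop) fun x hx => ?_
    have hx' : (0 : ℝ) ≤ x := hx
    rw [mem_Ioi]; linarith
  have h1 : asympConst (iteratedDeriv (p + 1) g) = ∫ t in (0 : ℝ)..1,
      (iteratedDeriv (p + 1) (Sig g) (t + 1) - iteratedDeriv (p + 1) (Sig g) 1) := by
    rw [asympConst]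
    refine intervalIntegral.integral_congr fun t ht => ?_
    have ht0 : 0 ≤ t := by simpa using ht.1
    simp only [hg.iteratedDeriv_sig_one hC, hg.iteratedDeriv_sig hC (x := t + 1) (by linarith)]
    ring
  have h2 : ∫ t in (0 : ℝ)..1, iteratedDeriv (p + 1) (Sig g) (t + 1) =
      iteratedDeriv p (Sig g) (1 + 1) - iteratedDeriv p (Sig g) (0 + 1) := by
    refine intervalIntegral.integral_eq_sub_of_hasDerivAt
      (f := fun t => iteratedDeriv p (Sig g) (t + 1)) (fun t ht => ?_) hi
    have ht0 : 0 ≤ t := by simpa using ht.1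
    exact (hf.hasDerivAt_iteratedDeriv (x := t + 1) (by linarith)).comp_add_const t 1
  have h3 : iteratedDeriv p (Sig g) (1 + 1) - iteratedDeriv p (Sig g) 1 = iteratedDeriv p g 1 := by
    have hf' : InC p (Sig g) := hf.mono (Nat.le_succ p)
    have c1 : ContDiffAt ℝ p (fun x => Sig g (x + 1)) 1 :=
      ContDiffAt.comp (g := Sig g) 1 (hf'.contDiffAt (by norm_num)) (by fun_prop)
    have c2 : iteratedDeriv p (fun x => Sig g (x + 1)) 1 = iteratedDeriv p (Sig g) (1 + 1) := by
      rw [iteratedDeriv_comp_add_const]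
    rw [← c2, ← iteratedDeriv_fun_sub c1 (hf'.contDiffAt one_pos)]
    refine EqOn.iteratedDeriv_of_isOpen (s := Ioi 0) (fun x hx => ?_) isOpen_Ioi p
      (mem_Ioi.2 one_pos)
    simp only [hg.sig_add_one (le_of_lt hx)]
    ring
  rw [h1, intervalIntegral.integral_sub hi intervalIntegrable_const, h2, zero_add, h3]
  simp

lemma weierTerm_eq (p : ℕ) (g : ℝ → ℝ) (k : ℕ) (x : ℝ) :
    weierTerm p g k x = eulerTerm p g k x +
      ((fwdDiff (1 : ℝ))^[p] g (k : ℝ) - iteratedDeriv p g (k : ℝ)) * (binomPoly p).eval x := by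
  rw [weierTerm, eulerTerm, Finset.sum_range_succ, eval_binomPoly]
  ring

/-- The polynomial part of the terms of the Weierstrassian series. -/
noncomputable def weierPoly (p : ℕ) (g : ℝ → ℝ) (k : ℕ) : ℝ[X] :=
  eulerPoly p g k - C ((fwdDiff (1 : ℝ))^[p] g (k : ℝ) - iteratedDeriv p g (k : ℝ)) * binomPoly p

lemma weierTerm_eq_shift (p : ℕ) (g : ℝ → ℝ) :
    weierTerm p g = fun (k : ℕ) x => g (x + k) - (weierPoly p g k).eval x := by
  ext k x
  rw [weierTerm_eq, eulerTerm_eq, weierPoly, eval_sub, eval_mul, eval_C]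
  ring

lemma natDegree_weierPoly_le (p : ℕ) (g : ℝ → ℝ) (k : ℕ) : (weierPoly p g k).natDegree ≤ p :=
  (natDegree_sub_le _ _).trans (max_le (natDegree_eulerPoly_le p g k)
    ((natDegree_C_mul_le _ _).trans (natDegree_binomPoly_le p)))

lemma InDK.sumsUniformlyOnBounded_weierTerm (hg : InDK p g) (hC : InC p g) :
    SumsUniformlyOnBounded (Ici 0) (weierTerm p g) fun x =>
      eulerSum p g x + diffDerivSum p g * (binomPoly p).eval x :=
  (hg.sumsUniformlyOnBounded.add (sumsUniformlyOnBounded_const_mul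
    (hg.tendsto_sum_fwdDiff_sub_deriv hC one_pos) (binomPoly p).continuous)).congr
    (fun k _ x _ => (weierTerm_eq p g k x).symm) (fun _ _ => rfl)

lemma InDK.differentiableTermwise_weierTerm (hg : InDK p g) (hC : InC (max p r) g)
    (hK : InK (max p r) g) : DifferentiableTermwise (max p r) (weierTerm p g) fun x =>
      eulerSum p g x + diffDerivSum p g * (binomPoly p).eval x := by
  have h := fun x (hx : x ∈ Ici (0 : ℝ)) =>
    (hg.sumsUniformlyOnBounded_weierTerm (hC.mono (le_max_left p r))).tendsto hx
  rw [weierTerm_eq_shift] at h ⊢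
  exact (hg.of_inK (le_max_left p r) hK).differentiableTermwise_shift hC le_rfl
    (natDegree_weierPoly_le p g) h

end WeierstrassHigher

end PrincipalSum

theorem mainTheorem7 (g : ℝ → ℝ) :
    -- Eulerian form
    (∀ p : ℕ, InDK p g →
      ∃ S : ℝ → ℝ,
        SumsUniformlyOnBounded (Ici 0) (eulerTerm p g) S ∧
        (∀ x : ℝ, 0 < x →
          Sig g x = -g x +
            ∑ j ∈ Finset.Icc 1 p, Ring.choose x j * ((fwdDiff (1 : ℝ))^[j - 1] g) 1 - S x) ∧
        (InC 0 g → InC 0 (Sig g) ∧ IntegrableTermwise (eulerTerm p g) S) ∧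
        (∀ r : ℕ, InC r g → InK (max p r) g →
          InC r (Sig g) ∧ DifferentiableTermwise r (eulerTerm p g) S)) ∧
    -- Weierstrassian form, degree `-1`
    (InC 0 g → InDK 0 g →
      (HasEulerConst g ∧ eulerConst g = asympConst g) ∧
      ∃ S : ℝ → ℝ,
        SumsUniformlyOnBounded (Ici 0) (weierTermZero g) S ∧
        (∀ x : ℝ, 0 < x → Sig g x = asympConst g - g x - S x) ∧
        (InC 0 (Sig g) ∧ IntegrableTermwise (weierTermZero g) S) ∧
        (∀ r : ℕ, InC r g → InK r g →
          InC r (Sig g) ∧ DifferentiableTermwise r (weierTermZero g) S)) ∧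
    -- Weierstrassian form, degree `p - 1 ≥ 0`
    (∀ p : ℕ, 1 ≤ p → InC p g → InDK p g → asympDeg g = (((p : ℤ) - 1 : ℤ) : WithTop ℤ) →
      (HasEulerConst (iteratedDeriv p g) ∧
        eulerConst (iteratedDeriv p g) = asympConst (iteratedDeriv p g) ∧
        asympConst (iteratedDeriv p g) =
          iteratedDeriv (p - 1) g 1 - iteratedDeriv p (Sig g) 1) ∧
      ∃ S : ℝ → ℝ,
        SumsUniformlyOnBounded (Ici 0) (weierTerm p g) S ∧
        (∀ x : ℝ, 0 < x →
          Sig g x =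
            ∑ j ∈ Finset.Icc 1 (p - 1), Ring.choose x j * ((fwdDiff (1 : ℝ))^[j - 1] g) 1 +
              Ring.choose x p * iteratedDeriv p (Sig g) 1 - g x - S x) ∧
        (InC p (Sig g) ∧ IntegrableTermwise (weierTerm p g) S) ∧
        (∀ r : ℕ, InC (max p r) g → InK (max p r) g →
          InC (max p r) (Sig g) ∧ DifferentiableTermwise (max p r) (weierTerm p g) S)) := by
  refine ⟨fun p hg => ?_, fun hC hg => ?_, fun p hp hC hg _ => ?_⟩
  · refine ⟨eulerSum p g, hg.sumsUniformlyOnBounded, fun x hx => hg.sig_eq hx.le,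
      fun hC => ⟨hg.inC_sig hC (by simpa using hg.2), ?_⟩,
      fun r hC hK => ⟨hg.inC_sig hC hK, hg.differentiableTermwise_eulerTerm hC hK⟩⟩
    exact hg.sumsUniformlyOnBounded.integrableTermwise fun k hk => continuousOn_eulerTerm hC hk
  · have hS := hg.sumsUniformlyOnBounded_weierTermZero hC
    refine ⟨hg.hasEulerConst hC, _, hS, fun x hx => ?_,
      ⟨hg.inC_sig hC hg.2, hS.integrableTermwise fun k hk => ?_⟩,
      fun r hCr hK => ⟨hg.inC_sig hCr (by simpa using hK),
        hg.differentiableTermwise_weierTermZero hCr hK⟩⟩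
    · rw [hg.sig_eq hx.le]
      simp
      ring
    · rw [weierTermZero_eq_shift]
      exact continuousOn_shift_sub (inC_zero_iff.1 hC) _ hk
  · have hS := hg.sumsUniformlyOnBounded_weierTerm hC
    have hC0 : InC 0 g := hC.mono (Nat.zero_le p)
    obtain ⟨p, rfl⟩ : ∃ q, p = q + 1 := ⟨p - 1, by omega⟩
    obtain ⟨h1, h2⟩ := (hg.inDK_zero_iteratedDeriv hC).hasEulerConst hC.inC_iteratedDeriv
    refine ⟨⟨h1, h2, hg.asympConst_iteratedDeriv hC⟩, _, hS, fun x hx => ?_,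
      ⟨hg.inC_sig hC (by simpa using hg.2), hS.integrableTermwise fun k hk => ?_⟩,
      fun r hCr hK => ⟨hg.inC_sig hCr (by simpa using hK),
        hg.differentiableTermwise_weierTerm hCr hK⟩⟩
    -- The top Eulerian coefficient `Δ^p g(1)` and the sum of the added number series combine to
    -- `(Σg)^{(p+1)}(1)`.
    · rw [hg.sig_eq hx.le, hg.iteratedDeriv_sig_one hC, Finset.sum_Icc_succ_top (by omega),
        eval_binomPoly, Nat.add_sub_cancel]
      ring
    · rw [weierTerm_eq_shift]
      exact continuousOn_shift_sub (inC_zero_iff.1 hC0) _ hk
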